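/- Let $\Omega\subset\mathbb R^2$ be a bounded polygonal domain with $\Omega=\operatorname{int}\overline\Omega$ (for example, one with Lipschitz boundary), let $\alpha_0<\pi$ and $C_0\in\mathbb R$. Let $u\in W^{2,\infty}(\Omega)$, identified with its representative that is continuous on $\overline\Omega$, and let $f\in L^2(\Omega)$ be such that $-\Delta u=f$ weakly, i.e. $a(u,v):=\int_\Omega\nabla u\cdot\nabla v\,dx=\int_\Omega fv\,dx$ for all $v\in H^1_0(\Omega)$. For a nondegenerate triangle $K$ with vertices $A_K,B_K,C_K$, labelled so that the maximum angle $\alpha_K$ is at $A_K$, put $h_K=\operatorname{diam}K$ and $r_K=\tfrac12\min\{|A_K-B_K|,|A_K-C_K|\}$. For a conforming triangulation $\mathcal T_h$ of $\overline\Omega$ let $h=\max_{K\in\mathcal T_h}h_K$, let $X_h$ be the space of functions that are continuous on $\overline\Omega$ and affine on each $K\in\mathcal T_h$, let $V_h=X_h\cap H^1_0(\Omega)$, and write $|v|_1=\|\nabla v\|_{L^2(\Omega)}$. For $g_h\in X_h$, a finite element solution with Dirichlet lift $g_h$ is a function $U\in X_h$ with $U-g_h\in V_h$ and $a(U,v_h)=\int_\Omega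 fv_h\,dx$ for all $v_h\in V_h$. Then there is a constant $C=C(u)$, which depends only on $\Omega,\alpha_0,C_0,u$ and not on the triangulation, such that the following holds for every conforming triangulation $\mathcal T_h$ of $\overline\Omega$ with a splitting $\mathcal T_h=\mathcal T_h^1\cup\mathcal T_h^2$ into disjoint subsets for which $\alpha_K\le\alpha_0$ for all $K\in\mathcal T_h^1$ and (i) $\sum_{K\in\mathcal T_h^2}h_K^2\le C_0$, (ii) $|A_K-A_{K'}|\ge r_K+r_{K'}$ for all $K\ne K'$ in $\mathcal T_h^2$, (iii) $|A_K-B_{K'}|\ge r_K$ and $|A_K-C_{K'}|\ge r_K$ for all $K,K'\in\mathcal T_h^2$. There is a discrete Dirichlet datum $g_h^0\in X_h$ such that, at vertices $P$ of $\mathcal T_h$ on $\partial\Omega$, $g_h^0(P)=u(P)$ whenever $|P-A_K|\ge r_K$ for all $K\in\mathcal T_h^2$, and $|g_h^0(P)-u(P)|\le C h_K^2$ whenever $|P-A_K|<r_K$ for some $K\in\mathcal T_h^2$; and for every $g_h\in X_h$ with $g_h=g_h^0$ on $\partial\Omega$ a finite element solution with lift $g_h$ exists and every such solution $U$ satisfies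 $$|u-U|_1\le C\,h .$$ In particular, if $|P-A_K|\ge r_K$ for all $K\in\mathcal T_h^2$ and all vertices $P\in\partial\Omega$, then $g_h^0$ is the piecewise linear Lagrange interpolation of $u$ on $\partial\Omega$; and in all cases $\inf_{v_h\in X_h}|u-v_h|_1\le C\,h$. -/

import Mathlib

open MeasureTheory Filter Topology
open scoped ContDiff ENNReal

noncomputable section

namespace FEM

/-- The Euclidean plane. -/
abbrev Plane : Type := EuclideanSpace ℝ (Fin 2)

/-! ### Sobolev spaces through weak derivatives -/

/-- Test functions on `Ω`: the space `C_c^∞(Ω)`. -/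
def IsTest (Ω : Set Plane) (φ : Plane → ℝ) : Prop :=
  ContDiff ℝ ∞ φ ∧ HasCompactSupport φ ∧ tsupport φ ⊆ Ω

/-- `G` is a weak gradient of `v` on the open set `Ω`. -/
def IsWeakGrad (Ω : Set Plane) (v : Plane → ℝ) (G : Plane → Plane) : Prop :=
  LocallyIntegrableOn v Ω ∧ LocallyIntegrableOn G Ω ∧
    ∀ φ : Plane → ℝ, IsTest Ω φ → ∀ i : Fin 2,
      ∫ x in Ω, v x * fderiv ℝ φ x (EuclideanSpace.single i 1) = - ∫ x in Ω, G x i * φ x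

open Classical in
/-- The weak gradient of `v` on `Ω` (unique up to null sets); `0` if there is none. -/
def weakGrad (Ω : Set Plane) (v : Plane → ℝ) : Plane → Plane :=
  if h : ∃ G, IsWeakGrad Ω v G then h.choose else 0

/-- `v ∈ H¹(Ω)`. -/
def MemH1 (Ω : Set Plane) (v : Plane → ℝ) : Prop :=
  MemLp v 2 (volume.restrict Ω) ∧
    ∃ G, IsWeakGrad Ω v G ∧ MemLp G 2 (volume.restrict Ω)

/-- `v ∈ H¹₀(Ω)`: the closure of `C_c^∞(Ω)` in `H¹(Ω)`. -/
def MemH10 (Ω : Set Plane) (v : Plane → ℝ) : Prop :=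
  MemH1 Ω v ∧ ∃ φ : ℕ → Plane → ℝ, (∀ n, IsTest Ω (φ n)) ∧
    Tendsto (fun n => eLpNorm (fun x => v x - φ n x) 2 (volume.restrict Ω)) atTop (𝓝 0) ∧
    Tendsto (fun n => eLpNorm (fun x => weakGrad Ω v x - gradient (φ n) x) 2
      (volume.restrict Ω)) atTop (𝓝 0)

/-- `v ∈ W^{2,∞}(Ω)`. -/
def MemW2Inf (Ω : Set Plane) (v : Plane → ℝ) : Prop :=
  MemLp v ∞ (volume.restrict Ω) ∧
    ∃ G, IsWeakGrad Ω v G ∧ MemLp G ∞ (volume.restrict Ω) ∧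
      ∀ i : Fin 2, ∃ H, IsWeakGrad Ω (fun x => G x i) H ∧ MemLp H ∞ (volume.restrict Ω)

/-- The bilinear form `a(v, w) = ∫_Ω ∇v · ∇w`. -/
def bilin (Ω : Set Plane) (v w : Plane → ℝ) : ℝ :=
  ∫ x in Ω, inner ℝ (weakGrad Ω v x) (weakGrad Ω w x)

/-- The seminorm `|v|_1 = (∫_Ω |∇v|²)^{1/2}` of `v ∈ H¹(Ω)`. -/
def h1Seminorm (Ω : Set Plane) (v : Plane → ℝ) : ℝ :=
  √(∫ x in Ω, ‖weakGrad Ω v x‖ ^ 2)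

/-- `u` is a weak solution of `-Δu = f` in `Ω` (with its own trace as Dirichlet datum). -/
def IsWeakSolution (Ω : Set Plane) (f u : Plane → ℝ) : Prop :=
  MemH1 Ω u ∧ ∀ v, MemH10 Ω v → bilin Ω u v = ∫ x in Ω, f x * v x

/-! ### Triangles and triangulations -/

/-- A nondegenerate triangle whose vertices are labelled so that its maximum angle is at `A`
(any such labelling is allowed if the maximum is attained more than once). -/
structure Triangle where
  A : Plane
  B : Plane
  C : Plane
  indep : AffineIndependent ℝ ![A, B, C]
  angle_B_le : EuclideanGeometry.angle A B C ≤ EuclideanGeometry.angle B A C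
  angle_C_le : EuclideanGeometry.angle A C B ≤ EuclideanGeometry.angle B A C

namespace Triangle

/-- The set of vertices. -/
def verts (K : Triangle) : Set Plane := {K.A, K.B, K.C}

/-- The closed triangle. -/
def carrier (K : Triangle) : Set Plane := convexHull ℝ K.verts

/-- The maximum angle `α_K`. -/
def maxAngle (K : Triangle) : ℝ := EuclideanGeometry.angle K.B K.A K.C

/-- The diameter `h_K`. -/
def diam (K : Triangle) : ℝ := Metric.diam K.carrier

/-- The radius `r_K`: half the distance from `A_K` to the nearer of the other two vertices. -/
def radius (K : Triangle) : ℝ := 1 / 2 * min (dist K.A K.B) (dist K.A K.C)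

end Triangle

/-- A conforming triangulation of (the closure of) `Ω`. -/
structure Triangulation (Ω : Set Plane) where
  elements : Finset Triangle
  cover : ⋃ K ∈ elements, K.carrier = closure Ω
  disjoint_interior : ∀ K ∈ elements, ∀ K' ∈ elements, K ≠ K' →
    Disjoint (interior K.carrier) (interior K'.carrier)
  /-- Two different elements meet in the empty set, a common vertex or a common edge. -/
  conforming : ∀ K ∈ elements, ∀ K' ∈ elements, K ≠ K' →
    K.carrier ∩ K'.carrier = convexHull ℝ (K.verts ∩ K'.verts)

namespace Triangulation

variable {Ω : Set Plane}

/-- The mesh size `h`: the maximal diameter of the elements. -/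
def meshSize (T : Triangulation Ω) : ℝ := sSup (Triangle.diam '' (T.elements : Set Triangle))

/-- The vertices of the triangulation that lie on the boundary of `Ω`. -/
def boundaryVerts (T : Triangulation Ω) : Set Plane :=
  {P | P ∈ frontier Ω ∧ ∃ K ∈ T.elements, P ∈ K.verts}

/-- `v ∈ X_h`: continuous on `closure Ω` and affine on every element. (Values outside
`closure Ω` are irrelevant.) -/
def MemX (T : Triangulation Ω) (v : Plane → ℝ) : Prop :=
  ContinuousOn v (closure Ω) ∧
    ∀ K ∈ T.elements, ∃ l : Plane →ᵃ[ℝ] ℝ, Set.EqOn v l K.carrier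

/-- `v ∈ V_h = X_h ∩ H¹₀(Ω)`. -/
def MemV (T : Triangulation Ω) (v : Plane → ℝ) : Prop := T.MemX v ∧ MemH10 Ω v

/-- `U` is the finite element solution for the right-hand side `f` and the discrete Dirichlet
lift `g ∈ X_h`: `U ∈ g + V_h` and `a(U, v) = (f, v)` for all `v ∈ V_h`. -/
def IsFEMSolution (T : Triangulation Ω) (f g U : Plane → ℝ) : Prop :=
  T.MemX U ∧ T.MemV (fun x => U x - g x) ∧
    ∀ v, T.MemV v → bilin Ω U v = ∫ x in Ω, f x * v x

/-- The conditions on the set `T₂` of possibly degenerate elements: `Σ h_K² ≤ C₀`, the open disks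
of radius `r_K` around the maximum-angle vertices `A_K` are pairwise disjoint, and none of them
contains a vertex `B_{K'}` or `C_{K'}`. -/
structure Separated (T₂ : Finset Triangle) (C₀ : ℝ) : Prop where
  sum_le : ∑ K ∈ T₂, K.diam ^ 2 ≤ C₀
  dist_A : ∀ K ∈ T₂, ∀ K' ∈ T₂, K ≠ K' → K.radius + K'.radius ≤ dist K.A K'.A
  dist_B : ∀ K ∈ T₂, ∀ K' ∈ T₂, K.radius ≤ dist K.A K'.B
  dist_C : ∀ K ∈ T₂, ∀ K' ∈ T₂, K.radius ≤ dist K.A K'.C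

/-- `g ∈ X_h` is a discrete Dirichlet datum for `u` adapted to `T₂`, with constant `C`: at the
boundary vertices it interpolates `u`, except that at those boundary vertices which lie in the disk
of radius `r_K` around `A_K` for some `K ∈ T₂` a perturbation of size `C h_K²` is allowed. -/
structure IsAdaptedDatum (T : Triangulation Ω) (T₂ : Finset Triangle) (u : Plane → ℝ) (C : ℝ)
    (g : Plane → ℝ) : Prop where
  memX : T.MemX g
  interp : ∀ P ∈ T.boundaryVerts, (∀ K ∈ T₂, K.radius ≤ dist P K.A) → g P = u P
  near : ∀ P ∈ T.boundaryVerts, ∀ K ∈ T₂, dist P K.A < K.radius → |g P - u P| ≤ C * K.diam ^ 2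

end Triangulation

end FEM

end

/-! Galerkin orthogonality bounds `|u - U|_1` by `|u - w|_1` for every `w ∈ X_h` with the boundary
values of `U`, so everything rests on a good `w`, whose boundary values then serve as `g_h^0`. On a
triangle whose maximum angle is bounded away from `π`, linear interpolation approximates `∇u` to
order `h_K`. On a degenerate triangle this fails, but changing the nodal value at `A_K` by
`O(h_K r_K)` restores it, because the derivative along the edge `B_K C_K` is accurate anyway. The
change is spread by a tent function supported in the disk of radius `r_K` around `A_K`: by the
separation conditions these disks do not interfere with each other or with the vertices `B`, `C` of
degenerate triangles. A nondegenerate neighbour sees at most three such tents, each of slope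
`O(h_{K'})`, which adds `O(∑ h_{K'}²)` times a disk of radius `2h` to the squared error; its
integral is `O(C_0 h²)`. -/

namespace FEM

/-! ### Lipschitz functions -/

lemma dist_le_of_finite_closed_cover {X ι : Type*} [PseudoMetricSpace X] [Finite ι]
    {F : ι → Set ℝ} (hF : ∀ i, IsClosed (F i)) (hcov : ∀ t, ∃ i, t ∈ F i) {f : ℝ → X} {C : NNReal}
    (hL : ∀ i, LipschitzOnWith C f (F i)) {a b : ℝ} (hab : a ≤ b) :
    dist (f b) (f a) ≤ C * (b - a) := by
  have hf : Continuous f := (locallyFinite_of_finite F).continuous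
    (Set.iUnion_eq_univ_iff.2 hcov) hF fun i => (hL i).continuousOn
  suffices Set.Icc a b ⊆ {t | dist (f t) (f a) ≤ C * (t - a)} from this ⟨hab, le_rfl⟩
  refine IsClosed.Icc_subset_of_forall_exists_gt
    ((isClosed_le (by fun_prop) (by fun_prop)).inter isClosed_Icc) (by simp) ?_
  rintro x ⟨hx, -⟩ y hxy
  obtain ⟨i, hi⟩ : ∃ i, ∃ᶠ s in 𝓝[>] x, s ∈ F i := by
    by_contra! hcon
    obtain ⟨s, hs⟩ := (eventually_all.2 hcon).exists
    obtain ⟨i, hsi⟩ := hcov s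
    exact hs i hsi
  have hxi : x ∈ F i := by
    rw [← (hF i).closure_eq, mem_closure_iff_frequently]
    exact hi.filter_mono nhdsWithin_le_nhds
  obtain ⟨s, hsi, hsx, hsy⟩ := (hi.and_eventually (Ioc_mem_nhdsGT hxy)).exists
  refine ⟨s, ?_, hsx, hsy⟩
  calc dist (f s) (f a) ≤ dist (f s) (f x) + dist (f x) (f a) := dist_triangle _ _ _
    _ ≤ C * (s - x) + C * (x - a) := by
        refine add_le_add ((hL i).dist_le_mul s hsi x hxi |>.trans_eq ?_) hx
        rw [Real.dist_eq, abs_of_pos (sub_pos.2 hsx)]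
    _ = C * (s - a) := by ring

lemma lipschitzWith_of_finite_closed_cover {E X ι : Type*} [NormedAddCommGroup E]
    [NormedSpace ℝ E] [PseudoMetricSpace X] [Finite ι] {F : ι → Set E}
    (hF : ∀ i, IsClosed (F i)) (hcov : ∀ x, ∃ i, x ∈ F i) {f : E → X} {C : NNReal}
    (hL : ∀ i, LipschitzOnWith C f (F i)) : LipschitzWith C f := by
  refine LipschitzWith.of_dist_le_mul fun x y => ?_
  have hline : LipschitzWith (nndist x y) (AffineMap.lineMap y x : ℝ → E) := by
    simpa only [nndist_comm] using lipschitzWith_lineMap (𝕜 := ℝ) y x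
  have h := dist_le_of_finite_closed_cover
    (F := fun i => (AffineMap.lineMap y x : ℝ → E) ⁻¹' F i)
    (fun i => (hF i).preimage hline.continuous) (fun t => hcov _)
    (fun i => (hL i).comp hline.lipschitzOnWith (Set.mapsTo_preimage _ _)) zero_le_one
  simpa using h

lemma integral_lineDeriv_eq_zero {E : Type*} [NormedAddCommGroup E] [NormedSpace ℝ E]
    [FiniteDimensional ℝ E] [MeasurableSpace E] [BorelSpace E] {μ : Measure E}
    [μ.IsAddHaarMeasure] {w : E → ℝ} {C : NNReal} (hw : LipschitzWith C w)
    (hc : HasCompactSupport w) (v : E) : ∫ x, lineDeriv ℝ w x v ∂μ = 0 := by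
  have h := (LipschitzWith.const (1 : ℝ)).integral_lineDeriv_mul_eq (μ := μ) hw hc (-v)
  simpa [lineDeriv] using h.symm

/-! ### Weak gradients -/

section WeakGradient

variable {Ω : Set Plane} {φ v w : Plane → ℝ} {G H : Plane → Plane}

namespace IsTest

lemma eq_zero_of_notMem (hφ : IsTest Ω φ) {x : Plane} (hx : x ∉ Ω) : φ x = 0 :=
  image_eq_zero_of_notMem_tsupport fun h => hx (hφ.2.2 h)

lemma setIntegral_mul (hφ : IsTest Ω φ) (v : Plane → ℝ) :
    ∫ x in Ω, v x * φ x = ∫ x, v x * φ x :=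
  setIntegral_eq_integral_of_forall_compl_eq_zero fun x hx => by
    rw [hφ.eq_zero_of_notMem hx, mul_zero]

lemma mono {D : Set Plane} (hφ : IsTest D φ) (hD : D ⊆ Ω) : IsTest Ω φ :=
  ⟨hφ.1, hφ.2.1, hφ.2.2.trans hD⟩

lemma integrableOn_mul (hφ : IsTest Ω φ) (hv : LocallyIntegrableOn v Ω) :
    IntegrableOn (fun x => v x * φ x) Ω := by
  have h : IntegrableOn (fun x => v x * φ x) (tsupport φ) :=
    (hv.integrableOn_compact_subset hφ.2.2 hφ.2.1).mul_continuousOn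
      hφ.1.continuous.continuousOn hφ.2.1
  rw [integrableOn_iff_integrable_of_support_subset] at h
  · exact h.integrableOn
  · exact (Function.support_mul_subset_right v φ).trans (subset_tsupport φ)

lemma fderiv_apply (hφ : IsTest Ω φ) (e : Plane) : IsTest Ω (fun x => fderiv ℝ φ x e) :=
  ⟨(hφ.1.fderiv_right (m := ∞) (by simp)).clm_apply contDiff_const, hφ.2.1.fderiv_apply ℝ e,
    (tsupport_fderiv_apply_subset ℝ e).trans hφ.2.2⟩

lemma sq (hφ : IsTest Ω φ) : IsTest Ω (fun x => φ x ^ 2) := by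
  have h : Function.support (fun x => φ x ^ 2) ⊆ Function.support φ := fun x hx hφx =>
    hx (by simp [hφx])
  exact ⟨hφ.1.pow 2, hφ.2.1.mono h, (closure_mono h).trans hφ.2.2⟩

end IsTest

lemma locallyIntegrableOn_inner (e : Plane) (hG : LocallyIntegrableOn G Ω) :
    LocallyIntegrableOn (fun x => inner ℝ e (G x)) Ω := fun x hx => by
  obtain ⟨s, hs, h⟩ := hG x hx
  exact ⟨s, hs, (innerSL ℝ e).integrable_comp h⟩

lemma locallyIntegrableOn_apply (hG : LocallyIntegrableOn G Ω) (i : Fin 2) :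
    LocallyIntegrableOn (fun x => G x i) Ω := by
  simpa [EuclideanSpace.inner_single_left] using
    locallyIntegrableOn_inner (EuclideanSpace.single i 1) hG

namespace IsWeakGrad

lemma integral_fderiv_apply (hv : IsWeakGrad Ω v G) (hφ : IsTest Ω φ) (e : Plane) :
    ∫ x in Ω, v x * fderiv ℝ φ x e = - ∫ x in Ω, inner ℝ e (G x) * φ x := by
  have he : e = ∑ i, e i • EuclideanSpace.single i (1 : ℝ) := by
    ext i; fin_cases i <;> simp
  have hleft (x) : v x * fderiv ℝ φ x e =
      ∑ i, e i * (v x * fderiv ℝ φ x (EuclideanSpace.single i 1)) := by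
    conv_lhs => rw [he]
    simp only [map_sum, map_smul, smul_eq_mul, Finset.mul_sum, mul_left_comm]
  have hright (x) : inner ℝ e (G x) * φ x = ∑ i, e i * (G x i * φ x) := by
    simp [PiLp.inner_apply]
    ring
  simp only [hleft, hright]
  rw [integral_finsetSum, integral_finsetSum, ← Finset.sum_neg_distrib]
  · simp only [integral_const_mul, hv.2.2 φ hφ, mul_neg]
  · exact fun i _ => (hφ.integrableOn_mul (locallyIntegrableOn_apply hv.2.1 i)).const_mul _
  · exact fun i _ => ((hφ.fderiv_apply _).integrableOn_mul hv.1).const_mul _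

lemma ae_eq (hΩ : IsOpen Ω) (hG : IsWeakGrad Ω v G) (hH : IsWeakGrad Ω v H) :
    G =ᵐ[volume.restrict Ω] H := by
  have hcoord (i : Fin 2) : ∀ᵐ x, x ∈ Ω → G x i - H x i = 0 := by
    have hGi := locallyIntegrableOn_apply hG.2.1 i
    have hHi := locallyIntegrableOn_apply hH.2.1 i
    refine hΩ.ae_eq_zero_of_integral_contDiff_smul_eq_zero (hGi.sub hHi) ?_
    intro φ hsmooth hcompact hsupp
    have hφ : IsTest Ω φ := ⟨hsmooth, hcompact, hsupp⟩
    simp only [smul_eq_mul, mul_comm (φ _)]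
    rw [← hφ.setIntegral_mul]
    simp only [sub_mul]
    rw [integral_sub (hφ.integrableOn_mul hGi) (hφ.integrableOn_mul hHi)]
    linarith [hG.2.2 φ hφ i, hH.2.2 φ hφ i]
  rw [EventuallyEq, ae_restrict_iff' hΩ.measurableSet]
  filter_upwards [hcoord 0, hcoord 1] with x h0 h1 hx
  ext i
  fin_cases i
  exacts [sub_eq_zero.1 (h0 hx), sub_eq_zero.1 (h1 hx)]

lemma weakGrad_ae_eq (hΩ : IsOpen Ω) (hG : IsWeakGrad Ω v G) :
    weakGrad Ω v =ᵐ[volume.restrict Ω] G := by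
  have h : ∃ G, IsWeakGrad Ω v G := ⟨G, hG⟩
  rw [weakGrad, dif_pos h]
  exact h.choose_spec.ae_eq hΩ hG

lemma add (hv : IsWeakGrad Ω v G) (hw : IsWeakGrad Ω w H) :
    IsWeakGrad Ω (fun x => v x + w x) (fun x => G x + H x) := by
  refine ⟨hv.1.add hw.1, hv.2.1.add hw.2.1, fun φ hφ i => ?_⟩
  have hd := hφ.fderiv_apply (EuclideanSpace.single i 1)
  simp only [add_mul, PiLp.add_apply]
  rw [integral_add (hd.integrableOn_mul hv.1) (hd.integrableOn_mul hw.1),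
    integral_add (hφ.integrableOn_mul (locallyIntegrableOn_apply hv.2.1 i))
      (hφ.integrableOn_mul (locallyIntegrableOn_apply hw.2.1 i)), hv.2.2 φ hφ i, hw.2.2 φ hφ i]
  ring

lemma const_mul (hv : IsWeakGrad Ω v G) (c : ℝ) :
    IsWeakGrad Ω (fun x => c * v x) (fun x => c • G x) := by
  refine ⟨hv.1.smul c, hv.2.1.smul c, fun φ hφ i => ?_⟩
  simp only [PiLp.smul_apply, smul_eq_mul, mul_assoc, integral_const_mul, hv.2.2 φ hφ i, mul_neg]

lemma sub (hv : IsWeakGrad Ω v G) (hw : IsWeakGrad Ω w H) :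
    IsWeakGrad Ω (fun x => v x - w x) (fun x => G x - H x) := by
  simpa [sub_eq_add_neg] using hv.add (hw.const_mul (-1))

lemma congr_left (hΩ : IsOpen Ω) (hv : IsWeakGrad Ω v G) (h : Set.EqOn v w Ω) :
    IsWeakGrad Ω w G := by
  refine ⟨hv.1.congr (h.aeEq_restrict hΩ.measurableSet), hv.2.1, fun φ hφ i => ?_⟩
  rw [← hv.2.2 φ hφ i]
  exact setIntegral_congr_fun hΩ.measurableSet fun x hx => by simp only [h hx]

lemma mono {D : Set Plane} (hD : D ⊆ Ω) (hv : IsWeakGrad Ω v G) : IsWeakGrad D v G := by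
  refine ⟨hv.1.mono_set hD, hv.2.1.mono_set hD, fun φ hφ i => ?_⟩
  have h := hv.2.2 φ (hφ.mono hD) i
  have hd := hφ.fderiv_apply (EuclideanSpace.single i 1)
  rwa [(hφ.mono hD).setIntegral_mul, (hd.mono hD).setIntegral_mul, ← hφ.setIntegral_mul,
    ← hd.setIntegral_mul] at h

end IsWeakGrad

lemma isWeakGrad_inner (Ω : Set Plane) (q : Plane) :
    IsWeakGrad Ω (fun x => inner ℝ q x) (fun _ => q) := by
  have hcont : Continuous fun x => inner ℝ q x := by fun_prop
  have hfd (x e : Plane) : fderiv ℝ (fun x => inner ℝ q x) x e = inner ℝ q e :=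
    congrArg (· e) (innerSL ℝ q).fderiv
  refine ⟨hcont.locallyIntegrable.locallyIntegrableOn _,
    continuous_const.locallyIntegrable.locallyIntegrableOn _, fun φ hφ i => ?_⟩
  have hd := hφ.fderiv_apply (EuclideanSpace.single i 1)
  have hint {f ψ : Plane → ℝ} (hf : Continuous f) (hψ : IsTest Ω ψ) :
      Integrable fun x => f x * ψ x :=
    (hf.mul hψ.1.continuous).integrable_of_hasCompactSupport hψ.2.1.mul_left
  rw [hφ.setIntegral_mul (fun _ => q i), hd.setIntegral_mul (fun x => inner ℝ q x),
    integral_mul_fderiv_eq_neg_fderiv_mul_of_integrable]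
  · simp [hfd, EuclideanSpace.inner_single_right]
  · simpa only [hfd] using hint continuous_const hφ
  · exact hint hcont hd
  · exact hint hcont hφ
  · exact fun x _ => (innerSL ℝ q).differentiableAt
  · exact fun x _ => hφ.1.differentiable (by simp) x

end WeakGradient

/-! ### Mollification -/

section Mollify

variable {E : Type*} [NormedAddCommGroup E]

/-- A fixed sequence of bump functions with supports shrinking to the origin. -/
noncomputable def bump (n : ℕ) : ContDiffBump (0 : E) where
  rIn := 1 / (n + 1) / 2
  rOut := 1 / (n + 1)
  rIn_pos := by positivity
  rIn_lt_rOut := half_lt_self (by positivity)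

lemma tendsto_bump_rOut : Tendsto (fun n => (bump n : ContDiffBump (0 : E)).rOut) atTop (𝓝 0) :=
  tendsto_one_div_add_atTop_nhds_zero_nat

lemma bump_rOut_le_one (n : ℕ) : (bump n : ContDiffBump (0 : E)).rOut ≤ 1 :=
  div_le_one_of_le₀ (le_add_of_nonneg_left n.cast_nonneg) (by positivity)

variable [InnerProductSpace ℝ E] [FiniteDimensional ℝ E] [MeasurableSpace E] [BorelSpace E]

/-- The mollification of `v`: its convolution with the normalized bump function `ρ`. -/
noncomputable def mollify (ρ : ContDiffBump (0 : E)) (v : E → ℝ) : E → ℝ :=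
  convolution (ρ.normed volume) v (ContinuousLinearMap.lsmul ℝ ℝ) volume

variable {v : E → ℝ} (ρ : ContDiffBump (0 : E))

lemma mollify_eq (v : E → ℝ) (x : E) :
    mollify ρ v x = ∫ t, ρ.normed volume t * v (x - t) := rfl

lemma contDiff_mollify (hv : LocallyIntegrable v) : ContDiff ℝ ∞ (mollify ρ v) :=
  ρ.hasCompactSupport_normed.contDiff_convolution_left (ContinuousLinearMap.lsmul ℝ ℝ)
    (ρ.contDiff_normed (n := ⊤)) hv

lemma integrable_normed_mul (hv : Continuous v) (x : E) :
    Integrable fun t => ρ.normed volume t * v (x - t) :=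
  (ρ.continuous_normed.mul (by fun_prop)).integrable_of_hasCompactSupport
    ρ.hasCompactSupport_normed.mul_right

lemma lipschitzWith_mollify {C : NNReal} (hv : LipschitzWith C v) :
    LipschitzWith C (mollify ρ v) := by
  refine LipschitzWith.of_dist_le_mul fun x y => ?_
  rw [Real.dist_eq, mollify_eq, mollify_eq, ← integral_sub
    (integrable_normed_mul ρ hv.continuous x) (integrable_normed_mul ρ hv.continuous y),
    ← Real.norm_eq_abs]
  calc _ ≤ ∫ t, ρ.normed volume t * (C * dist x y) := by
        refine norm_integral_le_of_norm_le (ρ.integrable_normed.mul_const _)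
          (.of_forall fun t => ?_)
        rw [← mul_sub, norm_mul, Real.norm_of_nonneg (ρ.nonneg_normed t)]
        refine mul_le_mul_of_nonneg_left ?_ (ρ.nonneg_normed t)
        simpa only [dist_sub_right, dist_eq_norm (v _)] using hv.dist_le_mul (x - t) (y - t)
    _ = C * dist x y := by rw [integral_mul_const, ρ.integral_normed, one_mul]

lemma abs_mollify_sub_le {C : NNReal} (hv : LipschitzWith C v) (x : E) :
    |mollify ρ v x - v x| ≤ C * ρ.rOut := by
  rw [← Real.dist_eq]
  refine ContDiffBump.dist_normed_convolution_le hv.continuous.aestronglyMeasurable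
    fun y hy => (hv.dist_le_mul y x).trans ?_
  exact mul_le_mul_of_nonneg_left (Metric.mem_ball.1 hy).le C.2

lemma mollify_eq_zero {x : E} (h : ∀ y ∈ Metric.ball x ρ.rOut, v y = 0) : mollify ρ v x = 0 := by
  have hx : v x = 0 := h x (Metric.mem_ball_self ρ.rOut_pos)
  exact (ρ.normed_convolution_eq_right fun y hy => by rw [h y hy, hx]).trans hx

lemma ae_tendsto_mollify (hv : LocallyIntegrable v) :
    ∀ᵐ x, Tendsto (fun n => mollify (bump n) v x) atTop (𝓝 (v x)) :=
  ContDiffBump.ae_convolution_tendsto_right_of_locallyIntegrable (K := 2) tendsto_bump_rOut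
    (.of_forall fun _ => (mul_div_cancel₀ _ two_ne_zero).ge) hv

lemma hasGradientAt_mollify (hv : Continuous v) {x c : E} {r : ℝ} (hr : ρ.rOut ≤ r)
    (h : ∀ y ∈ Metric.ball x (2 * r), v y = v x + inner ℝ c (y - x)) :
    HasGradientAt (mollify ρ v) c x := by
  have htranslate {z : E} (hz : ‖z - x‖ < r) (t : E) : ρ.normed volume t * v (z - t) =
      ρ.normed volume t * v (x - t) + ρ.normed volume t * inner ℝ c (z - x) := by
    by_cases ht : t ∈ Metric.ball (0 : E) ρ.rOut
    · have htr : ‖t‖ < r := (mem_ball_zero_iff.1 ht).trans_le hr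
      rw [h (z - t), h (x - t), ← mul_add, add_assoc, ← inner_add_right]
      · abel_nf
      · rw [mem_ball_iff_norm, sub_right_comm, sub_self, zero_sub, norm_neg]
        linarith [norm_nonneg t]
      · rw [mem_ball_iff_norm, sub_right_comm]
        linarith [norm_sub_le (z - x) t]
    · rw [← ρ.support_normed_eq (μ := volume), Function.notMem_support] at ht
      simp [ht]
  have haffine : mollify ρ v =ᶠ[𝓝 x] fun z => innerSL ℝ c z + (mollify ρ v x - inner ℝ c x) := by
    filter_upwards [Metric.ball_mem_nhds x (ρ.rOut_pos.trans_le hr)] with z hz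
    simp only [mollify_eq, htranslate (mem_ball_iff_norm.1 hz)]
    rw [integral_add (integrable_normed_mul ρ hv x) (ρ.integrable_normed.mul_const _),
      integral_mul_const, ρ.integral_normed, one_mul, inner_sub_right, innerSL_apply_apply]
    ring
  refine HasGradientAt.congr_of_eventuallyEq ?_ haffine
  rw [hasGradientAt_iff_hasFDerivAt]
  exact (innerSL ℝ c).hasFDerivAt.add_const _

end Mollify

/-! ### Functions with bounded weak gradient -/

section BoundedWeakGradient

variable {D : Set Plane} {v : Plane → ℝ} {H : Plane → Plane}

lemma isTest_normed_sub (ρ : ContDiffBump (0 : Plane)) {z : Plane}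
    (hz : Metric.closedBall z ρ.rOut ⊆ D) : IsTest D (fun t => ρ.normed volume (z - t)) := by
  have hsmooth : ContDiff ℝ ∞ (ρ.normed volume) := ρ.contDiff_normed (n := ⊤)
  refine ⟨by fun_prop, ρ.hasCompactSupport_normed.comp_homeomorph (Homeomorph.subLeft z),
    (closure_minimal (fun t ht => ?_) Metric.isClosed_closedBall).trans hz⟩
  have ht' : z - t ∈ Function.support (ρ.normed volume) := ht
  rw [ρ.support_normed_eq, mem_ball_zero_iff, norm_sub_rev] at ht'
  exact mem_closedBall_iff_norm.2 ht'.le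

lemma IsWeakGrad.fderiv_mollify (hD : MeasurableSet D) (hvi : IntegrableOn v D)
    (hv : IsWeakGrad D v H) (ρ : ContDiffBump (0 : Plane)) {z : Plane}
    (hz : Metric.closedBall z ρ.rOut ⊆ D) (e : Plane) :
    fderiv ℝ (mollify ρ (D.indicator v)) z e =
      ∫ t in D, inner ℝ e (H t) * ρ.normed volume (z - t) := by
  have hsmooth : ContDiff ℝ ∞ (ρ.normed volume : Plane → ℝ) := ρ.contDiff_normed (n := ⊤)
  have hvl : LocallyIntegrable (D.indicator v) :=
    ((integrable_indicator_iff hD).2 hvi).locallyIntegrable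
  have hex := (ρ.hasCompactSupport_normed.fderiv ℝ).convolutionExists_left
    ((ContinuousLinearMap.lsmul ℝ ℝ).precompL Plane) (hsmooth.continuous_fderiv (by simp)) hvl z
  have hchain (t : Plane) : fderiv ℝ (fun t => ρ.normed volume (z - t)) t e =
      -fderiv ℝ (ρ.normed volume) (z - t) e := by
    have h : HasFDerivAt (fun t => ρ.normed volume (z - t)) _ t :=
      (hsmooth.differentiable (by simp) (z - t)).hasFDerivAt.comp t
        ((hasFDerivAt_id t).const_sub z)
    simp [h.fderiv]
  rw [mollify, (ρ.hasCompactSupport_normed.hasFDerivAt_convolution_left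
      (ContinuousLinearMap.lsmul ℝ ℝ) (hsmooth.of_le (by simp)) hvl z).fderiv,
    convolution_eq_swap, ContinuousLinearMap.integral_apply hex.integrable_swap,
    ← neg_eq_iff_eq_neg.2 (hv.integral_fderiv_apply (isTest_normed_sub ρ hz) e), ← integral_neg,
    ← integral_indicator hD]
  refine integral_congr_ae (.of_forall fun t => ?_)
  by_cases ht : t ∈ D
  · simp [ht, hchain, ContinuousLinearMap.precompL_apply, mul_comm]
  · simp [ht]

lemma IsWeakGrad.norm_fderiv_mollify_le (hD : MeasurableSet D) (hvi : IntegrableOn v D)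
    (hv : IsWeakGrad D v H) {M : NNReal} (hM : ∀ᵐ x ∂(volume.restrict D), ‖H x‖ ≤ M)
    (ρ : ContDiffBump (0 : Plane)) {z : Plane} (hz : Metric.closedBall z ρ.rOut ⊆ D) :
    ‖fderiv ℝ (mollify ρ (D.indicator v)) z‖ ≤ M := by
  have hψ := isTest_normed_sub ρ hz
  have hmass : ∫ t in D, ρ.normed volume (z - t) = 1 := by
    simpa [integral_sub_left_eq_self, ρ.integral_normed] using hψ.setIntegral_mul 1
  refine ContinuousLinearMap.opNorm_le_bound _ M.2 fun e => ?_
  rw [hv.fderiv_mollify hD hvi ρ hz]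
  calc _ ≤ ∫ t in D, (M * ‖e‖) * ρ.normed volume (z - t) := by
        refine norm_integral_le_of_norm_le ((hψ.1.continuous.integrable_of_hasCompactSupport
          hψ.2.1).integrableOn.const_mul _) ?_
        filter_upwards [hM] with t ht
        rw [norm_mul, Real.norm_of_nonneg (ρ.nonneg_normed _), mul_comm (M : ℝ)]
        exact mul_le_mul_of_nonneg_right ((norm_inner_le_norm _ _).trans
          (mul_le_mul_of_nonneg_left ht (norm_nonneg _))) (ρ.nonneg_normed _)
    _ = M * ‖e‖ := by rw [integral_const_mul, hmass, mul_one]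

lemma IsWeakGrad.exists_lipschitzOnWith (hD : IsOpen D) (hconv : Convex ℝ D)
    (hvi : IntegrableOn v D) (hv : IsWeakGrad D v H) {M : NNReal}
    (hM : ∀ᵐ x ∂(volume.restrict D), ‖H x‖ ≤ M) :
    ∃ S ∈ ae (volume : Measure Plane), LipschitzOnWith M v (D ∩ S) := by
  have hvl : LocallyIntegrable (D.indicator v) :=
    ((integrable_indicator_iff hD.measurableSet).2 hvi).locallyIntegrable
  refine ⟨_, ae_tendsto_mollify hvl, LipschitzOnWith.of_dist_le_mul ?_⟩
  rintro x ⟨hx, hxlim⟩ y ⟨hy, hylim⟩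
  simp only [Set.mem_ofPred_eq, Set.indicator_of_mem, hx, hy] at hxlim hylim
  have hcompact : IsCompact (segment ℝ y x) := by
    rw [← convexHull_pair]
    exact (Set.toFinite _).isCompact_convexHull (𝕜 := ℝ)
  obtain ⟨δ, hδ, hδD⟩ := hcompact.exists_cthickening_subset_open hD
    (hconv.segment_subset hy hx)
  refine le_of_tendsto (hxlim.dist hylim) ?_
  filter_upwards [(tendsto_bump_rOut (E := Plane)).eventually (gt_mem_nhds hδ)] with n hn
  rw [dist_eq_norm, dist_eq_norm]
  refine (convex_segment y x).norm_image_sub_le_of_norm_fderiv_le (𝕜 := ℝ)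
    (fun z _ => (contDiff_mollify _ hvl).differentiable (by simp) z) (fun z hz => ?_)
    (left_mem_segment ℝ y x) (right_mem_segment ℝ y x)
  exact hv.norm_fderiv_mollify_le hD.measurableSet hvi hM (bump n)
    ((Metric.closedBall_subset_closedBall hn.le).trans
      ((Metric.closedBall_subset_cthickening hz δ).trans hδD))

end BoundedWeakGradient

section GradientApproximation

variable {Ω D : Set Plane} {u : Plane → ℝ} {G : Plane → Plane}

lemma exists_lipschitzOnWith_of_isWeakGrad_apply (hD : IsOpen D) (hconv : Convex ℝ D)
    (hGi : ∀ i, IntegrableOn (fun x => G x i) D) {H : Fin 2 → Plane → Plane}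
    (hH : ∀ i, IsWeakGrad D (fun x => G x i) (H i)) {M : NNReal}
    (hM : ∀ i, ∀ᵐ x ∂(volume.restrict D), ‖H i x‖ ≤ M) :
    ∃ S ∈ ae (volume : Measure Plane), LipschitzOnWith (2 * M) G (D ∩ S) := by
  choose S hS hlip using fun i => (hH i).exists_lipschitzOnWith hD hconv (hGi i) (hM i)
  refine ⟨S 0 ∩ S 1, inter_mem (hS 0) (hS 1), LipschitzOnWith.of_dist_le_mul ?_⟩
  rintro x ⟨hx, hx0, hx1⟩ y ⟨hy, hy0, hy1⟩
  have h0 := (hlip 0).dist_le_mul x ⟨hx, hx0⟩ y ⟨hy, hy0⟩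
  have h1 := (hlip 1).dist_le_mul x ⟨hx, hx1⟩ y ⟨hy, hy1⟩
  rw [EuclideanSpace.dist_eq, Fin.sum_univ_two, Real.sqrt_le_left (by positivity),
    NNReal.coe_mul, NNReal.coe_ofNat]
  nlinarith [pow_le_pow_left₀ dist_nonneg h0 2, pow_le_pow_left₀ dist_nonneg h1 2]

lemma IsWeakGrad.approximatesLinearOn_closure (hD : IsOpen D) (hconv : Convex ℝ D)
    (hui : IntegrableOn u D) (hb : Bornology.IsBounded D) (hu : IsWeakGrad D u G) {q : Plane}
    {m : NNReal} (hq : ∀ᵐ x ∂(volume.restrict D), ‖G x - q‖ ≤ m)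
    (huc : ContinuousOn u (closure D)) :
    ApproximatesLinearOn u (innerSL ℝ q) (closure D) m := by
  have hqi : IntegrableOn (fun x => inner ℝ q x) D :=
    ((by fun_prop : Continuous fun x => inner ℝ q x).continuousOn.integrableOn_compact
      hb.isCompact_closure).mono_set subset_closure
  obtain ⟨S, hS, hlip⟩ :=
    (hu.sub (isWeakGrad_inner D q)).exists_lipschitzOnWith hD hconv (hui.sub hqi) hq
  have hdense : D ⊆ closure (D ∩ S) := (Measure.dense_of_ae hS).open_subset_closure_inter hD
  have hclosure : closure D ⊆ closure (D ∩ S) := closure_minimal hdense isClosed_closure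
  rw [ApproximatesLinearOn.approximatesLinearOn_iff_lipschitzOnWith]
  refine (hlip.closure ?_).mono hclosure
  exact (huc.sub (by fun_prop)).mono (closure_mono Set.inter_subset_left)

lemma MemW2Inf.exists_approximatesLinearOn (hΩ : IsOpen Ω) (hu : MemW2Inf Ω u) :
    ∃ L : NNReal, ∀ D ⊆ Ω, IsOpen D → Convex ℝ D → D.Nonempty → Bornology.IsBounded D →
      ContinuousOn u (closure D) →
      ∃ q, (∀ᵐ x ∂(volume.restrict D), ‖weakGrad Ω u x - q‖ ≤ L * Metric.diam D) ∧
        ApproximatesLinearOn u (innerSL ℝ q) (closure D) (L * (Metric.diam D).toNNReal) := by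
  obtain ⟨hui, G, hG, hGi, hGH⟩ := hu
  choose H hH hHi using hGH
  let N (i : Fin 2) : NNReal := (lpNorm (H i) ∞ (volume.restrict Ω)).toNNReal
  let M : NNReal := Finset.univ.sup N
  have hM (i) : ∀ᵐ x ∂(volume.restrict Ω), ‖H i x‖ ≤ M := by
    filter_upwards [ae_le_lpNorm_exponent_top (hHi i)] with x hx
    exact hx.trans ((Real.le_coe_toNNReal _).trans (NNReal.coe_le_coe.2
      (Finset.le_sup (f := N) (Finset.mem_univ i))))
  refine ⟨2 * M, fun D hDΩ hD hconv hne hb huc => ?_⟩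
  have : IsFiniteMeasure (volume.restrict D) := isFiniteMeasure_restrict.2 hb.measure_lt_top.ne
  have hrestrict {p : Plane → Prop} (hp : ∀ᵐ x ∂(volume.restrict Ω), p x) :
      ∀ᵐ x ∂(volume.restrict D), p x := ae_mono (Measure.restrict_mono_set _ hDΩ) hp
  have hGD : IntegrableOn G D := (hGi.mono_measure (Measure.restrict_mono_set _ hDΩ)).integrable
    le_top
  obtain ⟨S, hS, hlip⟩ := exists_lipschitzOnWith_of_isWeakGrad_apply hD hconv
    (fun i => (EuclideanSpace.proj (𝕜 := ℝ) i : Plane →L[ℝ] ℝ).integrable_comp hGD)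
    (fun i => (hH i).mono hDΩ) (fun i => hrestrict (hM i))
  obtain ⟨x₀, hx₀⟩ := (Measure.dense_of_ae hS).inter_open_nonempty D hD hne
  have hGq : ∀ᵐ x ∂(volume.restrict D), ‖G x - G x₀‖ ≤ (2 * M : NNReal) * Metric.diam D := by
    filter_upwards [ae_restrict_of_ae hS, ae_restrict_mem hD.measurableSet] with x hxS hxD
    rw [← dist_eq_norm]
    refine (hlip.dist_le_mul x ⟨hxD, hxS⟩ x₀ hx₀).trans ?_
    exact mul_le_mul_of_nonneg_left (Metric.dist_le_diam_of_mem hb hxD hx₀.1) (by positivity)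
  refine ⟨G x₀, ?_, (hG.mono hDΩ).approximatesLinearOn_closure hD hconv ?_ hb ?_ huc⟩
  · filter_upwards [hGq, hrestrict (hG.weakGrad_ae_eq hΩ)] with x hx hxG
    rwa [hxG]
  · exact (hui.mono_measure (Measure.restrict_mono_set _ hDΩ)).integrable le_top
  · rwa [NNReal.coe_mul, Real.coe_toNNReal _ Metric.diam_nonneg]

end GradientApproximation

/-! ### Affine functions and triangles -/

lemma exists_norm_sub_le_and_inner_eq {E : Type*} [NormedAddCommGroup E] [InnerProductSpace ℝ E]
    {q e : E} {d m : ℝ} (he : e ≠ 0) (h : |d - inner ℝ q e| ≤ m * ‖e‖) :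
    ∃ p, ‖p - q‖ ≤ m ∧ inner ℝ p e = d := by
  have hne : 0 < ‖e‖ := norm_pos_iff.2 he
  refine ⟨q + ((d - inner ℝ q e) / ‖e‖ ^ 2) • e, ?_, ?_⟩
  · rw [add_sub_cancel_left, norm_smul, norm_div, norm_pow, norm_norm, Real.norm_eq_abs,
      div_mul_eq_mul_div, div_le_iff₀ (by positivity)]
    nlinarith
  · rw [inner_add_left, real_inner_smul_left, real_inner_self_eq_norm_sq,
      div_mul_cancel₀ _ (by positivity), add_sub_cancel]

lemma norm_inner_smul_sub_inner_smul (z a b : Plane) :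
    ‖inner ℝ z b • a - inner ℝ z a • b‖ =
      ‖z‖ * (Real.sin (InnerProductGeometry.angle a b) * (‖a‖ * ‖b‖)) := by
  have hnn : 0 ≤ inner ℝ a a * inner ℝ b b - inner ℝ a b * inner ℝ a b :=
    sub_nonneg.2 (real_inner_mul_inner_self_le a b)
  rw [InnerProductGeometry.sin_angle_mul_norm_mul_norm,
    ← sq_eq_sq₀ (norm_nonneg _) (by positivity), mul_pow, Real.sq_sqrt hnn]
  simp only [← real_inner_self_eq_norm_sq, PiLp.inner_apply, Fin.sum_univ_two]
  simp
  ring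

lemma norm_mul_sin_angle_le {z a b : Plane} {m : ℝ} (ha : a ≠ 0) (hb : b ≠ 0)
    (hza : |inner ℝ z a| ≤ m * ‖a‖) (hzb : |inner ℝ z b| ≤ m * ‖b‖) :
    ‖z‖ * Real.sin (InnerProductGeometry.angle a b) ≤ 2 * m := by
  have hpos : 0 < ‖a‖ * ‖b‖ := by positivity
  refine le_of_mul_le_mul_right ?_ hpos
  calc ‖z‖ * Real.sin (InnerProductGeometry.angle a b) * (‖a‖ * ‖b‖)
      = ‖inner ℝ z b • a - inner ℝ z a • b‖ := by
        rw [norm_inner_smul_sub_inner_smul, mul_assoc]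
    _ ≤ |inner ℝ z b| * ‖a‖ + |inner ℝ z a| * ‖b‖ := by
        simpa only [norm_smul, Real.norm_eq_abs] using
          norm_sub_le (inner ℝ z b • a) (inner ℝ z a • b)
    _ ≤ m * ‖b‖ * ‖a‖ + m * ‖a‖ * ‖b‖ := by gcongr
    _ = 2 * m * (‖a‖ * ‖b‖) := by ring

/-- The constant gradient of an affine function. -/
noncomputable def affineGrad (l : Plane →ᵃ[ℝ] ℝ) : Plane :=
  (InnerProductSpace.toDual ℝ Plane).symm (LinearMap.toContinuousLinearMap l.linear)

lemma inner_affineGrad (l : Plane →ᵃ[ℝ] ℝ) (x y : Plane) :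
    inner ℝ (affineGrad l) (x - y) = l x - l y := by
  rw [affineGrad, InnerProductSpace.toDual_symm_apply]
  exact l.linearMap_vsub x y

lemma affine_eq_inner_add (l : Plane →ᵃ[ℝ] ℝ) : ⇑l = fun x => inner ℝ (affineGrad l) x + l 0 :=
  funext fun x => by simpa using eq_add_of_sub_eq (inner_affineGrad l x 0).symm

lemma contDiff_affine (l : Plane →ᵃ[ℝ] ℝ) {n : WithTop ℕ∞} : ContDiff ℝ n l := by
  rw [affine_eq_inner_add l]
  exact (innerSL ℝ (affineGrad l)).contDiff.add contDiff_const

lemma hasGradientAt_affine (l : Plane →ᵃ[ℝ] ℝ) (x : Plane) :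
    HasGradientAt l (affineGrad l) x := by
  rw [hasGradientAt_iff_hasFDerivAt, affine_eq_inner_add l]
  exact (innerSL ℝ (affineGrad l)).hasFDerivAt.add_const _

namespace Triangle

variable (K : Triangle)

lemma finite_verts : K.verts.Finite := by simp [verts]

lemma A_mem_verts : K.A ∈ K.verts := by simp [verts]

lemma B_mem_verts : K.B ∈ K.verts := by simp [verts]

lemma C_mem_verts : K.C ∈ K.verts := by simp [verts]

lemma verts_eq_range : K.verts = Set.range ![K.A, K.B, K.C] := by
  rw [Matrix.range_cons, Matrix.range_cons, Matrix.range_cons, Matrix.range_empty, Set.union_empty,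
    Set.singleton_union, Set.singleton_union, verts]

lemma affineSpan_verts : affineSpan ℝ K.verts = ⊤ := by
  rw [verts_eq_range, K.indep.affineSpan_eq_top_iff_card_eq_finrank_add_one]
  simp

lemma A_ne_B : K.A ≠ K.B := K.indep.injective.ne (show (0 : Fin 3) ≠ 1 by decide)

lemma A_ne_C : K.A ≠ K.C := K.indep.injective.ne (show (0 : Fin 3) ≠ 2 by decide)

lemma B_ne_C : K.B ≠ K.C := K.indep.injective.ne (show (1 : Fin 3) ≠ 2 by decide)

lemma isCompact_carrier : IsCompact K.carrier := K.finite_verts.isCompact_convexHull (𝕜 := ℝ)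

lemma isClosed_carrier : IsClosed K.carrier := K.isCompact_carrier.isClosed

lemma convex_carrier : Convex ℝ K.carrier := convex_convexHull ℝ _

lemma verts_subset_carrier : K.verts ⊆ K.carrier := subset_convexHull ℝ _

lemma interior_carrier_nonempty : (interior K.carrier).Nonempty :=
  interior_convexHull_nonempty_iff_affineSpan_eq_top.2 K.affineSpan_verts

lemma closure_interior_carrier : closure (interior K.carrier) = K.carrier := by
  rw [K.convex_carrier.closure_interior_eq_closure_of_nonempty_interior
    K.interior_carrier_nonempty, K.isClosed_carrier.closure_eq]

lemma diam_interior_carrier : Metric.diam (interior K.carrier) = K.diam := by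
  rw [← Metric.diam_closure, closure_interior_carrier, diam]

lemma ae_mem_interior_carrier : ∀ᵐ x, x ∈ K.carrier → x ∈ interior K.carrier := by
  filter_upwards [measure_eq_zero_iff_ae_notMem.1 (K.convex_carrier.addHaar_frontier volume)]
    with x hx hxK
  by_contra hxi
  exact hx ⟨subset_closure hxK, hxi⟩

lemma dist_le_diam {x y : Plane} (hx : x ∈ K.carrier) (hy : y ∈ K.carrier) :
    dist x y ≤ K.diam :=
  Metric.dist_le_diam_of_mem K.isCompact_carrier.isBounded hx hy

lemma diam_nonneg : 0 ≤ K.diam := Metric.diam_nonneg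

lemma radius_pos : 0 < K.radius :=
  mul_pos one_half_pos (lt_min (dist_pos.2 K.A_ne_B) (dist_pos.2 K.A_ne_C))

lemma radius_le_half_diam : K.radius ≤ K.diam / 2 := by
  have hAB := K.dist_le_diam (K.verts_subset_carrier K.A_mem_verts)
    (K.verts_subset_carrier K.B_mem_verts)
  rw [radius]
  linarith [min_le_left (dist K.A K.B) (dist K.A K.C)]

lemma exists_affine_eqOn_verts (f : Plane → ℝ) : ∃ l : Plane →ᵃ[ℝ] ℝ, Set.EqOn l f K.verts := by
  let b : AffineBasis (Fin 3) ℝ Plane :=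
    ⟨![K.A, K.B, K.C], K.indep, by rw [← verts_eq_range, affineSpan_verts]⟩
  refine ⟨f K.A • b.coord 0 + f K.B • b.coord 1 + f K.C • b.coord 2, ?_⟩
  have hcoord (i j : Fin 3) : b.coord i (![K.A, K.B, K.C] j) = if i = j then 1 else 0 :=
    b.coord_apply i j
  have hA := (hcoord · 0)
  have hB := (hcoord · 1)
  have hC := (hcoord · 2)
  simp only [Matrix.cons_val] at hA hB hC
  rintro P (rfl | rfl | rfl) <;> simp [hA, hB, hC]

lemma norm_mul_sin_maxAngle_le {z : Plane} {m : ℝ}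
    (hB : |inner ℝ z (K.B - K.A)| ≤ m * ‖K.B - K.A‖)
    (hC : |inner ℝ z (K.C - K.A)| ≤ m * ‖K.C - K.A‖) :
    ‖z‖ * Real.sin K.maxAngle ≤ 2 * m :=
  norm_mul_sin_angle_le (sub_ne_zero.2 K.A_ne_B.symm) (sub_ne_zero.2 K.A_ne_C.symm) hB hC

lemma sin_maxAngle_pos : 0 < Real.sin K.maxAngle := by
  refine EuclideanGeometry.sin_pos_of_not_collinear fun h => ?_
  exact affineIndependent_iff_not_collinear_set.1 K.indep (by rwa [Set.insert_comm])

lemma pi_div_three_le_maxAngle : Real.pi / 3 ≤ K.maxAngle := by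
  have h := EuclideanGeometry.angle_add_angle_add_angle_eq_pi K.C K.A_ne_B.symm
  rw [EuclideanGeometry.angle_comm K.B K.C K.A, EuclideanGeometry.angle_comm K.C K.A K.B] at h
  have hB := K.angle_B_le
  have hC := K.angle_C_le
  rw [maxAngle]
  linarith

lemma norm_affineGrad_sub_mul_sin_le {l : Plane →ᵃ[ℝ] ℝ} {q : Plane} {m : NNReal}
    (hl : ApproximatesLinearOn l (innerSL ℝ q) K.verts m) :
    ‖affineGrad l - q‖ * Real.sin K.maxAngle ≤ 2 * m := by
  have hedge {P : Plane} (hP : P ∈ K.verts) :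
      |inner ℝ (affineGrad l - q) (P - K.A)| ≤ m * ‖P - K.A‖ := by
    rw [inner_sub_left, inner_affineGrad]
    exact hl P hP K.A K.A_mem_verts
  exact K.norm_mul_sin_maxAngle_le (hedge K.B_mem_verts) (hedge K.C_mem_verts)

lemma affineGrad_eq {l : Plane →ᵃ[ℝ] ℝ} {p : Plane} (hB : l K.B - l K.A = inner ℝ p (K.B - K.A))
    (hC : l K.C - l K.A = inner ℝ p (K.C - K.A)) : affineGrad l = p := by
  have h := K.norm_mul_sin_maxAngle_le (z := affineGrad l - p) (m := 0)
    (by simp [inner_sub_left, inner_affineGrad, hB])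
    (by simp [inner_sub_left, inner_affineGrad, hC])
  rw [← sub_eq_zero, ← norm_le_zero_iff]
  exact nonpos_of_mul_nonpos_left (by linarith) K.sin_maxAngle_pos

/-- Perturbing the value at `A` by `O(m r_K)` makes the gradient of the affine interpolant accurate
regardless of the shape of the triangle: the derivative along the edge `BC` is accurate anyway, so
that the nodal values at `B` and `C` are those of an affine function with a gradient close to `q`,
and this function determines the perturbation. -/
lemma exists_perturbation {u : Plane → ℝ} {q : Plane} {m : NNReal}
    (hu : ApproximatesLinearOn u (innerSL ℝ q) K.verts m) :
    ∃ δ : ℝ, |δ| ≤ 4 * m * K.radius ∧ ∀ l : Plane →ᵃ[ℝ] ℝ,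
      l K.A = u K.A + δ → l K.B = u K.B → l K.C = u K.C → ‖affineGrad l - q‖ ≤ m := by
  obtain ⟨p, hpq, hpBC⟩ := exists_norm_sub_le_and_inner_eq (sub_ne_zero.2 K.B_ne_C)
    (hu K.B K.B_mem_verts K.C K.C_mem_verts)
  let δ : ℝ := u K.B + inner ℝ p (K.A - K.B) - u K.A
  have hδC : δ = u K.C + inner ℝ p (K.A - K.C) - u K.A := by
    simp only [δ, inner_sub_right] at hpBC ⊢
    linarith
  have hδ {P : Plane} (hP : P ∈ K.verts) (h : δ = u P + inner ℝ p (K.A - P) - u K.A) :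
      |δ| ≤ 2 * m * dist K.A P := by
    have hu' := hu K.A K.A_mem_verts P hP
    have hp := (abs_real_inner_le_norm (p - q) (K.A - P)).trans
      (mul_le_mul_of_nonneg_right hpq (norm_nonneg _))
    rw [Real.norm_eq_abs, innerSL_apply_apply] at hu'
    rw [inner_sub_left] at hp
    rw [h, dist_eq_norm]
    rw [abs_le] at *
    constructor <;> linarith
  refine ⟨δ, ?_, fun l hA hB hC => ?_⟩
  · rw [radius]
    rcases min_choice (dist K.A K.B) (dist K.A K.C) with hmin | hmin <;> rw [hmin]
    · linarith [hδ K.B_mem_verts rfl]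
    · linarith [hδ K.C_mem_verts hδC]
  · suffices affineGrad l = p by rwa [this]
    refine K.affineGrad_eq ?_ ?_
    · rw [hA, hB, ← neg_sub K.A, inner_neg_right]
      ring
    · rw [hA, hC, hδC, ← neg_sub K.A, inner_neg_right]
      ring

end Triangle

lemma exists_pos_le_sin {β α : ℝ} (hβ : 0 < β) (hα : α < Real.pi) :
    ∃ κ > 0, ∀ θ, β ≤ θ → θ ≤ α → κ ≤ Real.sin θ := by
  rcases lt_or_ge α β with hαβ | hαβ
  · exact ⟨1, one_pos, fun θ h1 h2 => absurd (h1.trans h2) hαβ.not_ge⟩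
  obtain ⟨θ₀, ⟨h1, h2⟩, hmin⟩ := isCompact_Icc.exists_isMinOn (Set.nonempty_Icc.2 hαβ)
    Real.continuous_sin.continuousOn
  exact ⟨Real.sin θ₀, Real.sin_pos_of_pos_of_lt_pi (by linarith) (by linarith),
    fun θ h3 h4 => hmin ⟨h3, h4⟩⟩

/-! ### Finite element functions -/

namespace Triangulation

section Elements

variable {Ω : Set Plane} (T : Triangulation Ω) {K : Triangle}

lemma carrier_subset (hK : K ∈ T.elements) : K.carrier ⊆ closure Ω := by
  rw [← T.cover]
  exact Set.subset_biUnion_of_mem (u := fun K : Triangle => K.carrier) hK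

lemma exists_mem_carrier {x : Plane} (hx : x ∈ closure Ω) : ∃ K ∈ T.elements, x ∈ K.carrier := by
  simpa [← T.cover] using hx

lemma interior_carrier_subset (hreg : interior (closure Ω) = Ω) (hK : K ∈ T.elements) :
    interior K.carrier ⊆ Ω := by
  rw [← hreg]
  exact interior_mono (T.carrier_subset hK)

lemma ae_exists_mem_interior (hΩ : IsOpen Ω) :
    ∀ᵐ x ∂(volume.restrict Ω), ∃ K ∈ T.elements, x ∈ interior K.carrier := by
  have hint : ∀ᵐ x, ∀ K ∈ T.elements, x ∈ K.carrier → x ∈ interior K.carrier :=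
    T.elements.eventually_all.2 fun K _ => K.ae_mem_interior_carrier
  filter_upwards [ae_restrict_of_ae hint, ae_restrict_mem hΩ.measurableSet] with x hx hxΩ
  obtain ⟨K, hK, hxK⟩ := T.exists_mem_carrier (subset_closure hxΩ)
  exact ⟨K, hK, hx K hK hxK⟩

lemma diam_le_meshSize (hK : K ∈ T.elements) : K.diam ≤ T.meshSize :=
  le_csSup (T.elements.finite_toSet.image _).bddAbove ⟨K, hK, rfl⟩

lemma lipschitzWith_of_lipschitzOnWith_carrier (hΩ : IsOpen Ω) {w : Plane → ℝ} {C : NNReal}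
    (h0 : ∀ x ∉ Ω, w x = 0) (hw : ∀ K ∈ T.elements, LipschitzOnWith C w K.carrier) :
    LipschitzWith C w := by
  refine lipschitzWith_of_finite_closed_cover
    (F := fun o : Option T.elements => o.elim Ωᶜ fun K => K.1.carrier) ?_ (fun x => ?_) ?_
  · rintro (_ | K)
    exacts [hΩ.isClosed_compl, K.1.isClosed_carrier]
  · by_cases hx : x ∈ Ω
    · obtain ⟨K, hK, hxK⟩ := T.exists_mem_carrier (subset_closure hx)
      exact ⟨some ⟨K, hK⟩, hxK⟩
    · exact ⟨none, hx⟩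
  · rintro (_ | K)
    · exact LipschitzOnWith.of_dist_le_mul fun x hx y hy => by
        rw [h0 x hx, h0 y hy, dist_self]
        positivity
    · exact hw K.1 K.2

end Elements

section Interpolation

variable {Ω : Set Plane} (T : Triangulation Ω)

open Classical in
/-- The function on `closure Ω` which agrees with the affine function `l K` on each element `K`,
provided that these agree on the intersections of the elements. -/
noncomputable def glue (l : Triangle → Plane →ᵃ[ℝ] ℝ) (x : Plane) : ℝ :=
  if h : ∃ K ∈ T.elements, x ∈ K.carrier then l h.choose x else 0

variable {T}

lemma glue_eqOn {l : Triangle → Plane →ᵃ[ℝ] ℝ} (hl : ∀ K ∈ T.elements, ∀ K' ∈ T.elements,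
    Set.EqOn (l K) (l K') (K.verts ∩ K'.verts)) {K : Triangle} (hK : K ∈ T.elements) :
    Set.EqOn (T.glue l) (l K) K.carrier := by
  intro x hx
  have h : ∃ K ∈ T.elements, x ∈ K.carrier := ⟨K, hK, hx⟩
  obtain ⟨hK', hx'⟩ := h.choose_spec
  rw [glue, dif_pos h]
  by_cases hKK : h.choose = K
  · rw [hKK]
  · have hxhull : x ∈ convexHull ℝ (h.choose.verts ∩ K.verts) := by
      rw [← T.conforming _ hK' _ hK hKK]
      exact ⟨hx', hx⟩
    exact AffineMap.eqOn_affineSpan (hl _ hK' _ hK) (convexHull_subset_affineSpan _ hxhull)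

variable (T)

lemma exists_memX (f : Plane → ℝ) :
    ∃ v, T.MemX v ∧ ∀ K ∈ T.elements, Set.EqOn v f K.verts := by
  choose l hl using fun K : Triangle => K.exists_affine_eqOn_verts f
  have hglue : ∀ K ∈ T.elements, Set.EqOn (T.glue l) (l K) K.carrier := fun K hK =>
    glue_eqOn (fun K _ K' _ P hP => (hl K hP.1).trans (hl K' hP.2).symm) hK
  have hunion : closure Ω = ⋃ K : T.elements, K.1.carrier := by
    rw [← T.cover]
    ext x
    simp
  refine ⟨T.glue l, ⟨?_, fun K hK => ⟨l K, hglue K hK⟩⟩, fun K hK P hP => ?_⟩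
  · rw [hunion]
    exact (locallyFinite_of_finite _).continuousOn_iUnion (fun K => K.1.isClosed_carrier)
      fun K => (contDiff_affine (n := 0) (l K.1)).continuous.continuousOn.congr (hglue K.1 K.2)
  · rw [hglue K hK (K.verts_subset_carrier hP), hl K hP]

end Interpolation

namespace MemX

variable {Ω : Set Plane} {T : Triangulation Ω} {v w : Plane → ℝ}

lemma add (hv : T.MemX v) (hw : T.MemX w) : T.MemX (fun x => v x + w x) := by
  refine ⟨hv.1.add hw.1, fun K hK => ?_⟩
  obtain ⟨l, hl⟩ := hv.2 K hK
  obtain ⟨m, hm⟩ := hw.2 K hK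
  exact ⟨l + m, fun x hx => by simp [hl hx, hm hx]⟩

lemma const_mul (hv : T.MemX v) (c : ℝ) : T.MemX (fun x => c * v x) := by
  refine ⟨continuousOn_const.mul hv.1, fun K hK => ?_⟩
  obtain ⟨l, hl⟩ := hv.2 K hK
  exact ⟨c • l, fun x hx => by simp [hl hx]⟩

lemma sub (hv : T.MemX v) (hw : T.MemX w) : T.MemX (fun x => v x - w x) := by
  simpa [sub_eq_add_neg] using hv.add (hw.const_mul (-1))

lemma congr (hv : T.MemX v) (h : Set.EqOn w v (closure Ω)) : T.MemX w := by
  refine ⟨hv.1.congr h, fun K hK => ?_⟩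
  obtain ⟨l, hl⟩ := hv.2 K hK
  exact ⟨l, (h.mono (T.carrier_subset hK)).trans hl⟩

end MemX

end Triangulation

lemma hasGradientAt_of_eqOn_affine {s : Set Plane} {v : Plane → ℝ} {l : Plane →ᵃ[ℝ] ℝ}
    (hl : Set.EqOn v l s) {x : Plane} (hx : x ∈ interior s) : HasGradientAt v (affineGrad l) x :=
  (hasGradientAt_affine l x).congr_of_eventuallyEq
    (eventuallyEq_of_mem (mem_interior_iff_mem_nhds.1 hx) hl)

lemma measurable_gradient (v : Plane → ℝ) : Measurable (gradient v) :=
  (InnerProductSpace.toDual ℝ Plane).symm.continuous.measurable.comp (measurable_fderiv ℝ v)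

lemma gradient_apply (v : Plane → ℝ) (x : Plane) (i : Fin 2) :
    gradient v x i = fderiv ℝ v x (EuclideanSpace.single i 1) := by
  rw [← inner_gradient_left, EuclideanSpace.inner_single_right]
  simp

namespace Triangulation

section WeakGradient

variable {Ω : Set Plane} {T : Triangulation Ω} {v : Plane → ℝ}

lemma MemX.ae_differentiableAt (hΩ : IsOpen Ω) (hv : T.MemX v) :
    ∀ᵐ x ∂(volume.restrict Ω), DifferentiableAt ℝ v x := by
  filter_upwards [T.ae_exists_mem_interior hΩ] with x ⟨K, hK, hx⟩
  obtain ⟨l, hl⟩ := hv.2 K hK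
  exact (hasGradientAt_of_eqOn_affine hl hx).differentiableAt

lemma MemX.exists_norm_affineGrad_le (hv : T.MemX v) :
    ∃ C : NNReal, ∀ K ∈ T.elements, ∃ l : Plane →ᵃ[ℝ] ℝ,
      Set.EqOn v l K.carrier ∧ ‖affineGrad l‖ ≤ C := by
  choose! l hl using hv.2
  refine ⟨T.elements.sup fun K => ‖affineGrad (l K)‖₊, fun K hK => ⟨l K, hl K hK, ?_⟩⟩
  exact_mod_cast Finset.le_sup (f := fun K => ‖affineGrad (l K)‖₊) hK

lemma MemX.memLp_gradient (hΩ : IsOpen Ω) (hb : Bornology.IsBounded Ω) (hv : T.MemX v)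
    (p : ℝ≥0∞) : MemLp (gradient v) p (volume.restrict Ω) := by
  have : IsFiniteMeasure (volume.restrict Ω) := isFiniteMeasure_restrict.2 hb.measure_lt_top.ne
  obtain ⟨C, hC⟩ := hv.exists_norm_affineGrad_le
  refine MemLp.of_bound (measurable_gradient v).aestronglyMeasurable C ?_
  filter_upwards [T.ae_exists_mem_interior hΩ] with x ⟨K, hK, hx⟩
  obtain ⟨l, hl, hlC⟩ := hC K hK
  rwa [(hasGradientAt_of_eqOn_affine hl hx).gradient]

lemma MemX.memLp (hΩ : IsOpen Ω) (hb : Bornology.IsBounded Ω) (hv : T.MemX v) (p : ℝ≥0∞) :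
    MemLp v p (volume.restrict Ω) := by
  have : IsFiniteMeasure (volume.restrict Ω) := isFiniteMeasure_restrict.2 hb.measure_lt_top.ne
  obtain ⟨C, hC⟩ := hb.isCompact_closure.exists_bound_of_continuousOn hv.1
  refine MemLp.of_bound ((hv.1.mono subset_closure).aestronglyMeasurable hΩ.measurableSet) C ?_
  filter_upwards [ae_restrict_mem hΩ.measurableSet] with x hx using hC x (subset_closure hx)

lemma MemX.exists_lipschitzWith_mul (hΩ : IsOpen Ω) (hv : T.MemX v) {φ : Plane → ℝ}
    (hφ : IsTest Ω φ) : ∃ C, LipschitzWith C (fun x => φ x * v x) := by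
  choose! l hl using hv.2
  have hlip (K : Triangle) : ∃ C, LipschitzWith C (fun x => φ x * l K x) :=
    ContDiff.lipschitzWith_of_hasCompactSupport (𝕂 := ℝ) (n := 1) hφ.2.1.mul_right
      ((hφ.1.of_le (by simp)).mul (contDiff_affine _)) (by simp)
  choose C hC using hlip
  refine ⟨T.elements.sup C, T.lipschitzWith_of_lipschitzOnWith_carrier hΩ
    (fun x hx => by rw [hφ.eq_zero_of_notMem hx, zero_mul]) fun K hK => ?_⟩
  intro x hx y hy
  simpa only [hl K hK hx, hl K hK hy] using (hC K).weaken (Finset.le_sup hK) x y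

lemma MemX.isWeakGrad (hΩ : IsOpen Ω) (hb : Bornology.IsBounded Ω) (hv : T.MemX v) :
    IsWeakGrad Ω v (gradient v) := by
  have : IsFiniteMeasure (volume.restrict Ω) := isFiniteMeasure_restrict.2 hb.measure_lt_top.ne
  have hvi : LocallyIntegrableOn v Ω :=
    IntegrableOn.locallyIntegrableOn ((hv.memLp hΩ hb 1).integrable le_rfl)
  have hgi : LocallyIntegrableOn (gradient v) Ω :=
    IntegrableOn.locallyIntegrableOn ((hv.memLp_gradient hΩ hb 1).integrable le_rfl)
  refine ⟨hvi, hgi, fun φ hφ i => ?_⟩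
  let e : Plane := EuclideanSpace.single i 1
  obtain ⟨C, hC⟩ := hv.exists_lipschitzWith_mul hΩ hφ
  have houtside : ∀ x ∉ Ω, lineDeriv ℝ (fun x => φ x * v x) x e = 0 := fun x hx => by
    have h0 : (fun x => φ x * v x) =ᶠ[𝓝 x] fun _ => 0 := by
      filter_upwards [notMem_tsupport_iff_eventuallyEq.1 fun h => hx (hφ.2.2 h)] with y hy
      simp [hy]
    rw [h0.lineDeriv_eq]
    simp [lineDeriv]
  have hinside : ∀ᵐ x ∂(volume.restrict Ω), lineDeriv ℝ (fun x => φ x * v x) x e =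
      v x * fderiv ℝ φ x e + gradient v x i * φ x := by
    filter_upwards [hv.ae_differentiableAt hΩ] with x hx
    have hφx : DifferentiableAt ℝ φ x := hφ.1.differentiable (by simp) x
    rw [(hφx.fun_mul hx).lineDeriv_eq_fderiv, gradient_apply, fderiv_fun_mul hφx hx]
    simp [e]
    ring
  have hibp := integral_lineDeriv_eq_zero (μ := volume) hC hφ.2.1.mul_right e
  rw [← setIntegral_eq_integral_of_forall_compl_eq_zero houtside, integral_congr_ae hinside,
    integral_add ((hφ.fderiv_apply e).integrableOn_mul hvi)
      (hφ.integrableOn_mul (locallyIntegrableOn_apply hgi i))] at hibp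
  exact eq_neg_of_add_eq_zero_left hibp

lemma MemX.memH1 (hΩ : IsOpen Ω) (hb : Bornology.IsBounded Ω) (hv : T.MemX v) : MemH1 Ω v :=
  ⟨hv.memLp hΩ hb 2, gradient v, hv.isWeakGrad hΩ hb, hv.memLp_gradient hΩ hb 2⟩

end WeakGradient

end Triangulation

/-! ### The vector spaces `H¹` and `H¹₀` -/

section Sobolev

variable {Ω : Set Plane} {v w : Plane → ℝ} {G : Plane → Plane}

namespace MemH1

lemma isWeakGrad_weakGrad (hv : MemH1 Ω v) : IsWeakGrad Ω v (weakGrad Ω v) := by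
  have h : ∃ G, IsWeakGrad Ω v G := hv.2.imp fun _ => And.left
  rw [weakGrad, dif_pos h]
  exact h.choose_spec

lemma memLp_weakGrad (hΩ : IsOpen Ω) (hv : MemH1 Ω v) :
    MemLp (weakGrad Ω v) 2 (volume.restrict Ω) := by
  obtain ⟨-, G, hG, hG2⟩ := hv
  exact hG2.ae_eq (hG.weakGrad_ae_eq hΩ).symm

lemma add (hv : MemH1 Ω v) (hw : MemH1 Ω w) : MemH1 Ω (fun x => v x + w x) := by
  obtain ⟨hv2, G, hG, hG2⟩ := hv
  obtain ⟨hw2, H, hH, hH2⟩ := hw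
  exact ⟨hv2.add hw2, _, hG.add hH, hG2.add hH2⟩

lemma const_mul (hv : MemH1 Ω v) (c : ℝ) : MemH1 Ω (fun x => c * v x) := by
  obtain ⟨hv2, G, hG, hG2⟩ := hv
  exact ⟨hv2.const_mul c, _, hG.const_mul c, hG2.const_smul c⟩

lemma sub (hv : MemH1 Ω v) (hw : MemH1 Ω w) : MemH1 Ω (fun x => v x - w x) := by
  simpa [sub_eq_add_neg] using hv.add (hw.const_mul (-1))

lemma weakGrad_add (hΩ : IsOpen Ω) (hv : MemH1 Ω v) (hw : MemH1 Ω w) :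
    weakGrad Ω (fun x => v x + w x) =ᵐ[volume.restrict Ω]
      fun x => weakGrad Ω v x + weakGrad Ω w x :=
  (hv.isWeakGrad_weakGrad.add hw.isWeakGrad_weakGrad).weakGrad_ae_eq hΩ

lemma weakGrad_const_mul (hΩ : IsOpen Ω) (hv : MemH1 Ω v) (c : ℝ) :
    weakGrad Ω (fun x => c * v x) =ᵐ[volume.restrict Ω] fun x => c • weakGrad Ω v x :=
  (hv.isWeakGrad_weakGrad.const_mul c).weakGrad_ae_eq hΩ

lemma weakGrad_sub (hΩ : IsOpen Ω) (hv : MemH1 Ω v) (hw : MemH1 Ω w) :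
    weakGrad Ω (fun x => v x - w x) =ᵐ[volume.restrict Ω]
      fun x => weakGrad Ω v x - weakGrad Ω w x :=
  (hv.isWeakGrad_weakGrad.sub hw.isWeakGrad_weakGrad).weakGrad_ae_eq hΩ

lemma weakGrad_congr (hΩ : IsOpen Ω) (hv : MemH1 Ω v) (h : Set.EqOn v w Ω) :
    weakGrad Ω w =ᵐ[volume.restrict Ω] weakGrad Ω v :=
  (hv.isWeakGrad_weakGrad.congr_left hΩ h).weakGrad_ae_eq hΩ

end MemH1

namespace IsTest

variable {φ ψ : Plane → ℝ}

lemma add (hφ : IsTest Ω φ) (hψ : IsTest Ω ψ) : IsTest Ω (fun x => φ x + ψ x) :=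
  ⟨hφ.1.add hψ.1, hφ.2.1.add hψ.2.1,
    (tsupport_add φ ψ).trans (Set.union_subset hφ.2.2 hψ.2.2)⟩

lemma const_mul (hφ : IsTest Ω φ) (c : ℝ) : IsTest Ω (fun x => c * φ x) :=
  ⟨contDiff_const.mul hφ.1, hφ.2.1.mul_left,
    (closure_mono fun _ hx => right_ne_zero_of_mul hx).trans hφ.2.2⟩

lemma gradient_add (hφ : IsTest Ω φ) (hψ : IsTest Ω ψ) (x : Plane) :
    gradient (fun x => φ x + ψ x) x = gradient φ x + gradient ψ x := by
  simp only [gradient, fderiv_fun_add (hφ.1.differentiable (by simp) x)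
    (hψ.1.differentiable (by simp) x), map_add]

lemma gradient_const_mul (hφ : IsTest Ω φ) (c : ℝ) (x : Plane) :
    gradient (fun x => c * φ x) x = c • gradient φ x := by
  simp only [gradient, fderiv_const_mul (hφ.1.differentiable (by simp) x), map_smul]

lemma aestronglyMeasurable (hφ : IsTest Ω φ) (μ : Measure Plane) : AEStronglyMeasurable φ μ :=
  hφ.1.continuous.aestronglyMeasurable

end IsTest

lemma memH10_of_tendsto (hΩ : IsOpen Ω) (hv : MemLp v 2 (volume.restrict Ω))
    (hG : IsWeakGrad Ω v G) (hG2 : MemLp G 2 (volume.restrict Ω)) {φ : ℕ → Plane → ℝ}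
    (hφ : ∀ n, IsTest Ω (φ n))
    (hlim : Tendsto (fun n => eLpNorm (fun x => v x - φ n x) 2 (volume.restrict Ω)) atTop (𝓝 0))
    (hgrad : Tendsto (fun n => eLpNorm (fun x => G x - gradient (φ n) x) 2 (volume.restrict Ω))
      atTop (𝓝 0)) : MemH10 Ω v := by
  refine ⟨⟨hv, G, hG, hG2⟩, φ, hφ, hlim, hgrad.congr fun n => eLpNorm_congr_ae ?_⟩
  filter_upwards [hG.weakGrad_ae_eq hΩ] with x hx
  rw [hx]

lemma tendsto_eLpNorm_add {α E : Type*} [MeasurableSpace α] [NormedAddCommGroup E]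
    {μ : Measure α} {p : ℝ≥0∞} (hp : 1 ≤ p) {F G : ℕ → α → E}
    (hFm : ∀ n, AEStronglyMeasurable (F n) μ) (hGm : ∀ n, AEStronglyMeasurable (G n) μ)
    (hF : Tendsto (fun n => eLpNorm (F n) p μ) atTop (𝓝 0))
    (hG : Tendsto (fun n => eLpNorm (G n) p μ) atTop (𝓝 0)) :
    Tendsto (fun n => eLpNorm (fun x => F n x + G n x) p μ) atTop (𝓝 0) :=
  tendsto_of_tendsto_of_tendsto_of_le_of_le tendsto_const_nhds (by simpa using hF.add hG)
    (fun _ => zero_le) fun n => eLpNorm_add_le (hFm n) (hGm n) hp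

lemma tendsto_eLpNorm_const_smul {α E : Type*} [MeasurableSpace α] [NormedAddCommGroup E]
    [NormedSpace ℝ E] {μ : Measure α} {p : ℝ≥0∞} {F : ℕ → α → E}
    (hF : Tendsto (fun n => eLpNorm (F n) p μ) atTop (𝓝 0)) (c : ℝ) :
    Tendsto (fun n => eLpNorm (fun x => c • F n x) p μ) atTop (𝓝 0) := by
  have hlim := ENNReal.Tendsto.const_mul (a := ‖c‖ₑ) hF (Or.inr enorm_ne_top)
  rw [mul_zero] at hlim
  exact hlim.congr fun n => (eLpNorm_const_smul c (F n) p μ).symm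

namespace MemH10

lemma add (hΩ : IsOpen Ω) (hv : MemH10 Ω v) (hw : MemH10 Ω w) :
    MemH10 Ω (fun x => v x + w x) := by
  obtain ⟨hv1, φ, hφ, hφv, hφG⟩ := hv
  obtain ⟨hw1, ψ, hψ, hψw, hψH⟩ := hw
  refine memH10_of_tendsto hΩ (hv1.1.add hw1.1)
    (hv1.isWeakGrad_weakGrad.add hw1.isWeakGrad_weakGrad)
    ((hv1.memLp_weakGrad hΩ).add (hw1.memLp_weakGrad hΩ)) (fun n => (hφ n).add (hψ n)) ?_ ?_
  · simp only [add_sub_add_comm]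
    exact tendsto_eLpNorm_add one_le_two (fun n => hv1.1.1.sub ((hφ n).aestronglyMeasurable _))
      (fun n => hw1.1.1.sub ((hψ n).aestronglyMeasurable _)) hφv hψw
  · simp only [fun n => (hφ n).gradient_add (hψ n), add_sub_add_comm]
    exact tendsto_eLpNorm_add one_le_two
      (fun n => (hv1.memLp_weakGrad hΩ).1.sub (measurable_gradient _).aestronglyMeasurable)
      (fun n => (hw1.memLp_weakGrad hΩ).1.sub (measurable_gradient _).aestronglyMeasurable) hφG hψH

lemma const_mul (hΩ : IsOpen Ω) (hv : MemH10 Ω v) (c : ℝ) : MemH10 Ω (fun x => c * v x) := by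
  obtain ⟨hv1, φ, hφ, hφv, hφG⟩ := hv
  refine memH10_of_tendsto hΩ (hv1.1.const_mul c) (hv1.isWeakGrad_weakGrad.const_mul c)
    ((hv1.memLp_weakGrad hΩ).const_smul c) (fun n => (hφ n).const_mul c) ?_ ?_
  · simp only [← mul_sub]
    exact tendsto_eLpNorm_const_smul hφv c
  · simp only [fun n => (hφ n).gradient_const_mul c, ← smul_sub]
    exact tendsto_eLpNorm_const_smul hφG c

lemma congr (hΩ : IsOpen Ω) (hv : MemH10 Ω v) (h : Set.EqOn v w Ω) : MemH10 Ω w := by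
  obtain ⟨hv1, φ, hφ, hφv, hφG⟩ := hv
  have hae : v =ᵐ[volume.restrict Ω] w := by
    filter_upwards [ae_restrict_mem hΩ.measurableSet] with x hx using h hx
  refine memH10_of_tendsto hΩ (hv1.1.ae_eq hae) (hv1.isWeakGrad_weakGrad.congr_left hΩ h)
    (hv1.memLp_weakGrad hΩ) hφ (hφv.congr fun n => eLpNorm_congr_ae ?_) hφG
  filter_upwards [hae] with x hx
  rw [hx]

end MemH10

end Sobolev

/-! ### Friedrichs' inequality -/

section Friedrichs

variable {Ω : Set Plane} {φ v : Plane → ℝ}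

lemma eLpNorm_two_eq {α E : Type*} [MeasurableSpace α] [NormedAddCommGroup E] {μ : Measure α}
    {f : α → E} (hf : MemLp f 2 μ) : eLpNorm f 2 μ = ENNReal.ofReal (√(∫ x, ‖f x‖ ^ 2 ∂μ)) := by
  rw [hf.eLpNorm_eq_integral_rpow_norm (by simp) (by simp), Real.sqrt_eq_rpow]
  simp

lemma IsTest.memLp (hφ : IsTest Ω φ) (p : ℝ≥0∞) : MemLp φ p (volume.restrict Ω) :=
  (hφ.1.continuous.memLp_of_hasCompactSupport hφ.2.1).restrict _

lemma IsTest.memLp_gradient (hφ : IsTest Ω φ) (p : ℝ≥0∞) :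
    MemLp (gradient φ) p (volume.restrict Ω) := by
  let toGrad := (InnerProductSpace.toDual ℝ Plane).symm
  exact ((toGrad.continuous.comp (hφ.1.continuous_fderiv (by simp))).memLp_of_hasCompactSupport
    ((hφ.2.1.fderiv ℝ).comp_left (g := toGrad) (map_zero _))).restrict _

lemma IsTest.neg_inner_mul_fderiv_sq_le (hφ : IsTest Ω φ) {e x : Plane} (he : ‖e‖ = 1) {R : ℝ}
    (hx : ‖x‖ ≤ R) : -(inner ℝ e x * fderiv ℝ (fun x => φ x ^ 2) x e) ≤
      1 / 2 * φ x ^ 2 + 2 * R ^ 2 * ‖gradient φ x‖ ^ 2 := by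
  have hfderiv : fderiv ℝ (fun x => φ x ^ 2) x e = 2 * φ x * fderiv ℝ φ x e := by
    rw [fderiv_fun_pow _ (hφ.1.differentiable (by simp) x)]
    simp
  have hR : 0 ≤ R := (norm_nonneg x).trans hx
  have hinner : |inner ℝ e x| ≤ R := (abs_real_inner_le_norm e x).trans (by simpa [he] using hx)
  have hgrad : |fderiv ℝ φ x e| ≤ ‖gradient φ x‖ := by
    rw [← inner_gradient_left]
    simpa [he] using abs_real_inner_le_norm (gradient φ x) e
  have hprod : (inner ℝ e x * fderiv ℝ φ x e) ^ 2 ≤ (R * ‖gradient φ x‖) ^ 2 := by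
    rw [← sq_abs, abs_mul]
    gcongr
  rw [hfderiv]
  nlinarith [sq_nonneg (φ x + 2 * (inner ℝ e x * fderiv ℝ φ x e))]

lemma IsTest.integral_sq_le (hΩ : MeasurableSet Ω) {R : ℝ} (hR : ∀ x ∈ Ω, ‖x‖ ≤ R)
    (hφ : IsTest Ω φ) : ∫ x in Ω, φ x ^ 2 ≤ (2 * R) ^ 2 * ∫ x in Ω, ‖gradient φ x‖ ^ 2 := by
  let e : Plane := EuclideanSpace.single 0 1
  have he : ‖e‖ = 1 := by simp [e]
  have hsq : IntegrableOn (fun x => φ x ^ 2) Ω := (hφ.memLp 2).integrable_sq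
  have hgrad : IntegrableOn (fun x => ‖gradient φ x‖ ^ 2) Ω :=
    (hφ.memLp_gradient 2).integrable_norm_pow (by simp)
  have hint : IntegrableOn (fun x => inner ℝ e x * fderiv ℝ (fun x => φ x ^ 2) x e) Ω :=
    (hφ.sq.fderiv_apply e).integrableOn_mul (isWeakGrad_inner Ω e).1
  have hibp := (isWeakGrad_inner Ω e).integral_fderiv_apply hφ.sq e
  simp only [real_inner_self_eq_norm_sq, he, one_pow, one_mul] at hibp
  have hle : ∫ x in Ω, φ x ^ 2 ≤
      1 / 2 * (∫ x in Ω, φ x ^ 2) + 2 * R ^ 2 * ∫ x in Ω, ‖gradient φ x‖ ^ 2 := by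
    rw [← integral_const_mul, ← integral_const_mul,
      ← integral_add (hsq.const_mul _) (hgrad.const_mul _), ← neg_eq_iff_eq_neg.2 hibp,
      ← integral_neg]
    exact setIntegral_mono_on hint.neg ((hsq.const_mul _).add (hgrad.const_mul _)) hΩ
      fun x hx => hφ.neg_inner_mul_fderiv_sq_le he (hR x hx)
  linarith

lemma IsTest.eLpNorm_le (hΩ : MeasurableSet Ω) {R : ℝ} (hR0 : 0 ≤ R) (hR : ∀ x ∈ Ω, ‖x‖ ≤ R)
    (hφ : IsTest Ω φ) : eLpNorm φ 2 (volume.restrict Ω) ≤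
      ENNReal.ofReal (2 * R) * eLpNorm (gradient φ) 2 (volume.restrict Ω) := by
  rw [eLpNorm_two_eq (hφ.memLp 2), eLpNorm_two_eq (hφ.memLp_gradient 2),
    ← ENNReal.ofReal_mul (by positivity)]
  refine ENNReal.ofReal_le_ofReal (Real.sqrt_le_iff.2 ⟨by positivity, ?_⟩)
  rw [mul_pow, Real.sq_sqrt (integral_nonneg fun x => by positivity)]
  simpa only [Real.norm_eq_abs, sq_abs] using hφ.integral_sq_le hΩ hR

lemma MemH10.ae_eq_zero (hΩ : MeasurableSet Ω) (hb : Bornology.IsBounded Ω) (hv : MemH10 Ω v)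
    (h0 : weakGrad Ω v =ᵐ[volume.restrict Ω] 0) : v =ᵐ[volume.restrict Ω] 0 := by
  obtain ⟨R, hR0, hR⟩ := hb.exists_pos_norm_le
  obtain ⟨hv1, φ, hφ, hφv, hφG⟩ := hv
  have hgrad (n : ℕ) : eLpNorm (fun x => weakGrad Ω v x - gradient (φ n) x) 2
      (volume.restrict Ω) = eLpNorm (gradient (φ n)) 2 (volume.restrict Ω) := by
    rw [← eLpNorm_neg (gradient (φ n))]
    refine eLpNorm_congr_ae ?_
    filter_upwards [h0] with x hx
    simp [hx]
  simp only [hgrad] at hφG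
  have hle (n : ℕ) : eLpNorm v 2 (volume.restrict Ω) ≤
      eLpNorm (fun x => v x - φ n x) 2 (volume.restrict Ω) +
        ENNReal.ofReal (2 * R) * eLpNorm (gradient (φ n)) 2 (volume.restrict Ω) := by
    have hφm := (hφ n).aestronglyMeasurable (volume.restrict Ω)
    have hadd := eLpNorm_add_le (p := 2) (hv1.1.1.sub hφm) hφm one_le_two
    rw [sub_add_cancel] at hadd
    exact hadd.trans (add_le_add le_rfl ((hφ n).eLpNorm_le hΩ hR0.le hR))
  have hlim := hφv.add (ENNReal.Tendsto.const_mul (a := ENNReal.ofReal (2 * R)) hφG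
    (Or.inr ENNReal.ofReal_ne_top))
  rw [mul_zero, add_zero] at hlim
  exact (eLpNorm_eq_zero_iff hv1.1.1 (by simp)).1
    (le_antisymm (ge_of_tendsto' hlim hle) zero_le)

end Friedrichs

/-! ### Lipschitz functions in `H¹₀` -/

section Shrink

/-- Soft thresholding: moves `t` by `ε` towards zero, and sends the interval `[-ε, ε]` to zero. -/
noncomputable def shrink (ε t : ℝ) : ℝ := t - max (-ε) (min ε t)

variable {ε t : ℝ}

lemma lipschitzWith_shrink (hε : 0 ≤ ε) : LipschitzWith 1 (shrink ε) :=
  LipschitzWith.of_dist_le_mul fun s t => by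
    simp only [NNReal.coe_one, one_mul, Real.dist_eq, shrink]
    grind

lemma abs_shrink_sub_le (hε : 0 ≤ ε) : |shrink ε t - t| ≤ ε := by
  unfold shrink
  grind

lemma shrink_of_abs_le (h : |t| ≤ ε) : shrink ε t = 0 := by
  unfold shrink
  grind

lemma shrink_of_le (hε : 0 ≤ ε) (h : ε ≤ t) : shrink ε t = t - ε := by
  unfold shrink
  grind

lemma shrink_of_le_neg (hε : 0 ≤ ε) (h : t ≤ -ε) : shrink ε t = t + ε := by
  unfold shrink
  grind

variable {E : Type*} [NormedAddCommGroup E] [InnerProductSpace ℝ E]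

lemma eventually_shrink_eq {v : E → ℝ} {x c : E}
    (hlin : ∀ᶠ y in 𝓝 x, v y = v x + inner ℝ c (y - x)) (h0 : v x = 0 → c = 0) :
    ∀ᶠ p : ℝ × E in 𝓝[>] 0 ×ˢ 𝓝 x,
      shrink p.1 (v p.2) = shrink p.1 (v x) + inner ℝ c (p.2 - x) := by
  have hcont : ContinuousAt v x := by
    refine ContinuousAt.congr (f := fun y => v x + inner ℝ c (y - x)) (by fun_prop) ?_
    exact hlin.mono fun _ => Eq.symm
  have hpos : ∀ᶠ ε : ℝ in 𝓝[>] 0, 0 < ε := eventually_mem_nhdsWithin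
  have hsmall {r : ℝ} (hr : 0 < r) : ∀ᶠ ε in 𝓝[>] 0, ε < r :=
    eventually_nhdsWithin_of_eventually_nhds (gt_mem_nhds hr)
  rcases lt_trichotomy (v x) 0 with hneg | hzero | hpos'
  · filter_upwards [(hpos.and (hsmall (r := -(v x / 2)) (by linarith))).prod_mk
      (hlin.and (hcont.eventually (gt_mem_nhds (show v x < v x / 2 by linarith))))]
      with ⟨ε, y⟩ ⟨⟨hε, hεx⟩, hy, hyx⟩
    rw [shrink_of_le_neg hε.le (by linarith), shrink_of_le_neg hε.le (by linarith), hy]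
    ring
  · filter_upwards [hlin.prod_inr _] with ⟨ε, y⟩ hy
    rw [hy, h0 hzero, inner_zero_left, add_zero, add_zero]
  · filter_upwards [(hpos.and (hsmall (r := v x / 2) (by linarith))).prod_mk
      (hlin.and (hcont.eventually (lt_mem_nhds (show v x / 2 < v x by linarith))))]
      with ⟨ε, y⟩ ⟨⟨hε, hεx⟩, hy, hyx⟩
    rw [shrink_of_le hε.le (by linarith), shrink_of_le hε.le (by linarith), hy]
    ring

end Shrink

section InnerMollify

variable {E : Type*} [NormedAddCommGroup E] {v : E → ℝ} {C : NNReal} (ρ : ContDiffBump (0 : E))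

lemma lipschitzWith_shrink_comp (hv : LipschitzWith C v) :
    LipschitzWith C fun y => shrink ((C + 1) * ρ.rOut) (v y) := by
  have hpos : 0 < (C + 1) * ρ.rOut := mul_pos (by positivity) ρ.rOut_pos
  have := (lipschitzWith_shrink hpos.le).comp hv
  rwa [one_mul] at this

variable [InnerProductSpace ℝ E] [FiniteDimensional ℝ E] [MeasurableSpace E] [BorelSpace E]

/-- The mollification of a `C`-Lipschitz function `v` after shrinking its values by an amount which
makes the result vanish near the zeros of `v`. -/
noncomputable def innerMollify (C : NNReal) (ρ : ContDiffBump (0 : E)) (v : E → ℝ) : E → ℝ :=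
  mollify ρ fun y => shrink ((C + 1) * ρ.rOut) (v y)

lemma lipschitzWith_innerMollify (hv : LipschitzWith C v) :
    LipschitzWith C (innerMollify C ρ v) :=
  lipschitzWith_mollify ρ (lipschitzWith_shrink_comp ρ hv)

lemma contDiff_innerMollify (hv : LipschitzWith C v) : ContDiff ℝ ∞ (innerMollify C ρ v) :=
  contDiff_mollify ρ (lipschitzWith_shrink_comp ρ hv).continuous.locallyIntegrable

lemma tsupport_innerMollify_subset (hv : LipschitzWith C v) :
    tsupport (innerMollify C ρ v) ⊆ {x | ρ.rOut ≤ |v x|} := by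
  refine closure_minimal (fun x hx => ?_) (isClosed_le continuous_const hv.continuous.abs)
  by_contra! hlt
  rw [Set.mem_ofPred_eq, not_le] at hlt
  refine hx (mollify_eq_zero ρ fun y hy => shrink_of_abs_le ?_)
  have hvy : |v y - v x| ≤ C * ρ.rOut := (hv.dist_le_mul y x).trans
    (mul_le_mul_of_nonneg_left (Metric.mem_ball.1 hy).le C.2)
  linarith [abs_sub_abs_le_abs_sub (v y) (v x)]

lemma abs_sub_innerMollify_le (hv : LipschitzWith C v) (x : E) :
    |v x - innerMollify C ρ v x| ≤ (2 * C + 1) * ρ.rOut := by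
  have hmoll : |innerMollify C ρ v x - _| ≤ _ :=
    abs_mollify_sub_le ρ (lipschitzWith_shrink_comp ρ hv) x
  have hpos : 0 < (C + 1) * ρ.rOut := mul_pos (by positivity) ρ.rOut_pos
  have hshrink := abs_shrink_sub_le (t := v x) hpos.le
  rw [abs_sub_comm] at hmoll hshrink
  linarith [abs_sub_le (v x) (shrink ((C + 1) * ρ.rOut) (v x)) (innerMollify C ρ v x)]

lemma eventually_hasGradientAt_innerMollify (hv : LipschitzWith C v) {x c : E}
    (hlin : ∀ᶠ y in 𝓝 x, v y = v x + inner ℝ c (y - x)) (h0 : v x = 0 → c = 0) :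
    ∀ᶠ n in atTop, HasGradientAt (innerMollify C (bump n) v) c x := by
  obtain ⟨small, hsmall, near, hnear, heq⟩ := eventually_prod_iff.1 (eventually_shrink_eq hlin h0)
  obtain ⟨r, hr, hball⟩ := Metric.eventually_nhds_iff_ball.1 hnear
  have hlim : Tendsto (fun n => (C + 1) * (bump n : ContDiffBump (0 : E)).rOut) atTop (𝓝[>] 0) := by
    refine tendsto_nhdsWithin_iff.2 ⟨?_, .of_forall fun n =>
      mul_pos (by positivity) (bump n).rOut_pos⟩
    simpa using (tendsto_bump_rOut (E := E)).const_mul ((C : ℝ) + 1)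
  have hsupp := (tendsto_bump_rOut (E := E)).eventually (gt_mem_nhds (half_pos hr))
  filter_upwards [hlim.eventually hsmall, hsupp] with n hn hnr
  have hcont := (lipschitzWith_shrink_comp (bump n) hv).continuous
  refine hasGradientAt_mollify (bump n) hcont hnr.le fun y hy => ?_
  rw [mul_div_cancel₀ _ two_ne_zero] at hy
  exact heq hn (hball y hy)

end InnerMollify

lemma tendsto_eLpNorm_of_bounded {α E : Type*} [MeasurableSpace α] [NormedAddCommGroup E]
    {μ : Measure α} [IsFiniteMeasure μ] {p : ℝ≥0∞} (hp : 1 ≤ p) (hp' : p ≠ ⊤) {F : ℕ → α → E}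
    (hF : ∀ n, AEStronglyMeasurable (F n) μ) {C : ℝ} (hC : ∀ n, ∀ᵐ x ∂μ, ‖F n x‖ ≤ C)
    (h : ∀ᵐ x ∂μ, Tendsto (fun n => F n x) atTop (𝓝 0)) :
    Tendsto (fun n => eLpNorm (F n) p μ) atTop (𝓝 0) := by
  have hunif : UnifIntegrable F p μ := fun ε hε => by
    obtain ⟨δ, hδ, hs⟩ := unifIntegrable_const (ι := ℕ) hp hp' (memLp_const (μ := μ) C) hε
    refine ⟨δ, hδ, fun n s hsm hsδ => (eLpNorm_mono_ae ?_).trans (hs n s hsm hsδ)⟩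
    filter_upwards [hC n] with x hx
    simp only [norm_indicator_eq_indicator_norm]
    exact Set.indicator_le_indicator (hx.trans (le_abs_self C))
  simpa using tendsto_Lp_finite_of_tendsto_ae hp hp' hF MemLp.zero hunif h

lemma tendsto_eLpNorm_sub_innerMollify {μ : Measure Plane} [IsFiniteMeasure μ] {v : Plane → ℝ}
    {C : NNReal} (hv : LipschitzWith C v) :
    Tendsto (fun n => eLpNorm (v - innerMollify C (bump n) v) 2 μ) atTop (𝓝 0) := by
  have hclose := fun n => abs_sub_innerMollify_le (bump n) hv
  refine tendsto_eLpNorm_of_bounded (C := (2 * C + 1) * 1) one_le_two ENNReal.ofNat_ne_top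
    (fun n => (hv.continuous.sub (contDiff_innerMollify _ hv).continuous).aestronglyMeasurable)
    (fun n => .of_forall fun x => (hclose n x).trans ?_) (.of_forall fun x => ?_)
  · gcongr
    exact bump_rOut_le_one n
  · refine squeeze_zero_norm (hclose · x) ?_
    simpa using (tendsto_bump_rOut (E := Plane)).const_mul (2 * C + 1 : ℝ)

lemma memH10_of_lipschitzWith {Ω : Set Plane} (hΩ : IsOpen Ω) (hb : Bornology.IsBounded Ω)
    {v : Plane → ℝ} {C : NNReal} (hv : LipschitzWith C v) (h0 : ∀ x ∉ Ω, v x = 0)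
    {G : Plane → Plane} (hG : IsWeakGrad Ω v G)
    (haffine : ∀ᵐ x ∂(volume.restrict Ω),
      (∀ᶠ y in 𝓝 x, v y = v x + inner ℝ (G x) (y - x)) ∧ (v x = 0 → G x = 0)) :
    MemH10 Ω v := by
  have : IsFiniteMeasure (volume.restrict Ω) := isFiniteMeasure_restrict.2 hb.measure_lt_top.ne
  have hgradient : ∀ᵐ x ∂(volume.restrict Ω),
      ∀ᶠ n in atTop, HasGradientAt (innerMollify C (bump n) v) (G x) x :=
    haffine.mono fun x hx => eventually_hasGradientAt_innerMollify hv hx.1 hx.2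
  have hbound (n : ℕ) (x : Plane) : ‖gradient (innerMollify C (bump n) v) x‖ ≤ C := by
    rw [gradient, LinearIsometryEquiv.norm_map]
    exact norm_fderiv_le_of_lipschitz ℝ (lipschitzWith_innerMollify _ hv)
  have hGbound : ∀ᵐ x ∂(volume.restrict Ω), ‖G x‖ ≤ C := by
    filter_upwards [hgradient] with x hx
    obtain ⟨n, hn⟩ := hx.exists
    exact hn.gradient ▸ hbound n x
  have hsub (n : ℕ) : tsupport (innerMollify C (bump n) v) ⊆ Ω := fun x hx => by
    by_contra hxΩ
    have := tsupport_innerMollify_subset _ hv hx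
    rw [Set.mem_ofPred_eq, h0 x hxΩ, abs_zero] at this
    exact this.not_gt (bump n).rOut_pos
  obtain ⟨M, hM⟩ := hb.isCompact_closure.exists_bound_of_continuousOn hv.continuous.continuousOn
  refine memH10_of_tendsto hΩ (φ := fun n => innerMollify C (bump n) v)
    (MemLp.of_bound hv.continuous.aestronglyMeasurable M ?_) hG
    (MemLp.of_bound (hG.2.1.aestronglyMeasurable) C hGbound) (fun n => ⟨contDiff_innerMollify _ hv,
      Metric.isCompact_of_isClosed_isBounded (isClosed_tsupport _) (hb.subset (hsub n)),
      hsub n⟩) (tendsto_eLpNorm_sub_innerMollify hv) ?_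
  · filter_upwards [ae_restrict_mem hΩ.measurableSet] with x hx using hM x (subset_closure hx)
  · refine tendsto_eLpNorm_of_bounded (C := C + C) one_le_two ENNReal.ofNat_ne_top
      (fun n => (hG.2.1.aestronglyMeasurable).sub (measurable_gradient _).aestronglyMeasurable)
      (fun n => hGbound.mono fun x hx => (norm_sub_le _ _).trans (add_le_add hx (hbound n x))) ?_
    filter_upwards [hgradient] with x hx
    refine tendsto_const_nhds.congr' (hx.mono fun n hn => ?_)
    simp only [hn.gradient, sub_self]

lemma lipschitzWith_affine {l : Plane →ᵃ[ℝ] ℝ} {C : NNReal} (h : ‖affineGrad l‖ ≤ C) :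
    LipschitzWith C l := by
  refine LipschitzWith.of_dist_le_mul fun x y => ?_
  rw [Real.dist_eq, ← inner_affineGrad, dist_eq_norm]
  exact (abs_real_inner_le_norm _ _).trans (mul_le_mul_of_nonneg_right h (norm_nonneg _))

lemma ae_affine_ne_zero {l : Plane →ᵃ[ℝ] ℝ} (hl : affineGrad l ≠ 0) : ∀ᵐ x, l x ≠ 0 := by
  let S : AffineSubspace ℝ Plane := (AffineSubspace.mk' (0 : ℝ) ⊥).comap l
  have hS (x : Plane) : x ∈ S ↔ l x = 0 := by simp [S]
  have hne : S ≠ ⊤ := by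
    refine fun h => hl ?_
    have hzero (x : Plane) : l x = 0 := (hS x).1 (h ▸ AffineSubspace.mem_top ℝ Plane x)
    rw [← inner_self_eq_zero (𝕜 := ℝ)]
    simpa only [sub_zero, hzero] using inner_affineGrad l (affineGrad l) 0
  filter_upwards [measure_eq_zero_iff_ae_notMem.1 (Measure.addHaar_affineSubspace volume S hne)]
    with x hx hx0
  exact hx ((hS x).2 hx0)

namespace Triangulation.MemX

variable {Ω : Set Plane} {T : Triangulation Ω} {v : Plane → ℝ}

lemma ae_eventually_eq_inner_add (hΩ : IsOpen Ω) (hv : T.MemX v) :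
    ∀ᵐ x ∂(volume.restrict Ω), (∀ᶠ y in 𝓝 x, v y = v x + inner ℝ (gradient v x) (y - x)) ∧
      (v x = 0 → gradient v x = 0) := by
  choose! l hl using hv.2
  have hne : ∀ᵐ x, ∀ K ∈ T.elements, affineGrad (l K) ≠ 0 → l K x ≠ 0 :=
    T.elements.eventually_all.2 fun K _ => by
      by_cases h : affineGrad (l K) = 0
      · exact .of_forall fun _ hK => (hK h).elim
      · exact (ae_affine_ne_zero h).mono fun _ hx _ => hx
  filter_upwards [T.ae_exists_mem_interior hΩ, ae_restrict_of_ae hne] with x ⟨K, hK, hx⟩ hne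
  rw [(hasGradientAt_of_eqOn_affine (hl K hK) hx).gradient, hl K hK (interior_subset hx)]
  refine ⟨?_, fun h0 => not_imp_comm.1 (hne K hK) (not_not_intro h0)⟩
  filter_upwards [mem_interior_iff_mem_nhds.1 hx] with y hy
  rw [hl K hK hy, inner_affineGrad]
  ring

lemma indicator_eqOn (hΩ : IsOpen Ω) (h0 : ∀ x ∈ frontier Ω, v x = 0) :
    Set.EqOn (Ω.indicator v) v (closure Ω) := by
  intro x hx
  by_cases hxΩ : x ∈ Ω
  · exact Set.indicator_of_mem hxΩ v
  · rw [Set.indicator_of_notMem hxΩ, h0 x (hΩ.frontier_eq ▸ ⟨hx, hxΩ⟩)]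

lemma lipschitzWith_indicator (hΩ : IsOpen Ω) (hv : T.MemX v)
    (h0 : ∀ x ∈ frontier Ω, v x = 0) : ∃ C, LipschitzWith C (Ω.indicator v) := by
  obtain ⟨C, hC⟩ := hv.exists_norm_affineGrad_le
  refine ⟨C, T.lipschitzWith_of_lipschitzOnWith_carrier hΩ
    (fun x hx => Set.indicator_of_notMem hx v) fun K hK => ?_⟩
  obtain ⟨l, hl, hlC⟩ := hC K hK
  have heq := ((indicator_eqOn hΩ h0).mono (T.carrier_subset hK)).trans hl
  intro x hx y hy
  rw [heq hx, heq hy]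
  exact lipschitzWith_affine hlC x y

lemma memH10 (hΩ : IsOpen Ω) (hb : Bornology.IsBounded Ω) (hv : T.MemX v)
    (h0 : ∀ x ∈ frontier Ω, v x = 0) : MemH10 Ω v := by
  have heq : Set.EqOn (Ω.indicator v) v Ω := Set.eqOn_indicator
  obtain ⟨C, hC⟩ := hv.lipschitzWith_indicator hΩ h0
  refine (memH10_of_lipschitzWith (G := gradient v) hΩ hb hC
    (fun x hx => Set.indicator_of_notMem hx v) ?_ ?_).congr hΩ heq
  · exact (hv.isWeakGrad hΩ hb).congr_left hΩ heq.symm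
  · filter_upwards [hv.ae_eventually_eq_inner_add hΩ, ae_restrict_mem hΩ.measurableSet]
      with x hx hxΩ
    rw [heq hxΩ]
    refine ⟨?_, hx.2⟩
    filter_upwards [hx.1, hΩ.mem_nhds hxΩ] with y hy hyΩ
    rw [heq hyΩ, hy]

end Triangulation.MemX

/-! ### The energy form -/

section Energy

variable {Ω : Set Plane} {v w z : Plane → ℝ}

lemma bilin_comm (Ω : Set Plane) (v w : Plane → ℝ) : bilin Ω v w = bilin Ω w v := by
  simp only [bilin, real_inner_comm]

lemma bilin_congr_right (hΩ : IsOpen Ω) (z : Plane → ℝ) (hv : MemH1 Ω v) (h : Set.EqOn v w Ω) :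
    bilin Ω z w = bilin Ω z v :=
  integral_congr_ae ((hv.weakGrad_congr hΩ h).mono fun x hx => by simp only [hx])

lemma integrable_inner {α E : Type*} [MeasurableSpace α] [NormedAddCommGroup E]
    [InnerProductSpace ℝ E] {μ : Measure α} {F G : α → E} (hF : MemLp F 2 μ) (hG : MemLp G 2 μ) :
    Integrable (fun x => inner ℝ (F x) (G x)) μ :=
  (hF.norm.integrable_mul hG.norm).mono' (hF.1.inner hG.1)
    (.of_forall fun _ => norm_inner_le_norm _ _)

lemma MemH1.bilin_add_left (hΩ : IsOpen Ω) (hv : MemH1 Ω v) (hw : MemH1 Ω w) (hz : MemH1 Ω z) :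
    bilin Ω (fun x => v x + w x) z = bilin Ω v z + bilin Ω w z := by
  have hz2 := hz.memLp_weakGrad hΩ
  rw [bilin, bilin, bilin, ← integral_add (integrable_inner (hv.memLp_weakGrad hΩ) hz2)
    (integrable_inner (hw.memLp_weakGrad hΩ) hz2)]
  refine integral_congr_ae ((hv.weakGrad_add hΩ hw).mono fun x hx => ?_)
  simp only [hx, inner_add_left]

lemma MemH1.bilin_const_mul_left (hΩ : IsOpen Ω) (hv : MemH1 Ω v) (c : ℝ) (z : Plane → ℝ) :
    bilin Ω (fun x => c * v x) z = c * bilin Ω v z := by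
  rw [bilin, bilin, ← integral_const_mul]
  refine integral_congr_ae ((hv.weakGrad_const_mul hΩ c).mono fun x hx => ?_)
  simp only [hx, real_inner_smul_left]

/-- The space `H¹(Ω)`, its elements being functions rather than classes. -/
def h1Space (Ω : Set Plane) : Submodule ℝ (Plane → ℝ) where
  carrier := {v | MemH1 Ω v}
  add_mem' := MemH1.add
  zero_mem' := ⟨MemLp.zero, 0, ⟨locallyIntegrable_zero.locallyIntegrableOn _,
    locallyIntegrable_zero.locallyIntegrableOn _, by simp⟩, MemLp.zero⟩
  smul_mem' c _ hv := hv.const_mul c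

/-- The form `a` as a bilinear form on `H¹(Ω)`. -/
noncomputable def energy (hΩ : IsOpen Ω) : LinearMap.BilinForm ℝ (h1Space Ω) :=
  LinearMap.mk₂ ℝ (fun v w => bilin Ω v w)
    (fun v w z => v.2.bilin_add_left hΩ w.2 z.2)
    (fun c v z => v.2.bilin_const_mul_left hΩ c z)
    (fun z v w => by
      simp only [bilin_comm Ω z]
      exact v.2.bilin_add_left hΩ w.2 z.2)
    (fun c z v => by
      simp only [bilin_comm Ω z]
      exact v.2.bilin_const_mul_left hΩ c z)

/-- The functional `v ↦ ∫ f v` on `H¹(Ω)`. -/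
noncomputable def load {f : Plane → ℝ} (hf : MemLp f 2 (volume.restrict Ω)) :
    Module.Dual ℝ (h1Space Ω) where
  toFun v := ∫ x in Ω, f x * v.1 x
  map_add' v w := (integral_congr_ae (.of_forall fun _ => mul_add _ _ _)).trans
    (integral_add (hf.integrable_mul v.2.1) (hf.integrable_mul w.2.1))
  map_smul' c _ := (integral_congr_ae (.of_forall fun _ => mul_left_comm _ _ _)).trans
    (integral_const_mul c _)

lemma energy_self (hΩ : IsOpen Ω) (v : h1Space Ω) :
    energy hΩ v v = ∫ x in Ω, ‖weakGrad Ω v x‖ ^ 2 :=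
  integral_congr_ae (.of_forall fun _ => real_inner_self_eq_norm_sq _)

lemma MemH10.ae_eq_zero_of_energy_self (hΩ : IsOpen Ω) (hb : Bornology.IsBounded Ω)
    {v : h1Space Ω} (hv : MemH10 Ω v) (h0 : energy hΩ v v = 0) :
    v.1 =ᵐ[volume.restrict Ω] 0 := by
  have hint : Integrable (fun x => ‖weakGrad Ω v x‖ ^ 2) (volume.restrict Ω) :=
    (v.2.memLp_weakGrad hΩ).integrable_norm_pow two_ne_zero
  rw [energy_self, integral_eq_zero_iff_of_nonneg (fun x => by positivity) hint] at h0
  exact hv.ae_eq_zero hΩ.measurableSet hb (h0.mono fun x hx => by simpa using hx)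

lemma h1Seminorm_le_of_bilin_eq_zero (hΩ : IsOpen Ω) (hv : MemH1 Ω v) (hw : MemH1 Ω w)
    (horth : bilin Ω v w = 0) :
    h1Seminorm Ω v ≤ h1Seminorm Ω fun x => v x + w x := by
  let v' : h1Space Ω := ⟨v, hv⟩
  let w' : h1Space Ω := ⟨w, hw⟩
  have hvw : energy hΩ v' w' = 0 := horth
  have hwv : energy hΩ w' v' = 0 := (bilin_comm Ω w v).trans horth
  have hww : 0 ≤ energy hΩ w' w' := energy_self hΩ w' ▸ integral_nonneg fun x => by positivity
  refine Real.sqrt_le_sqrt ?_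
  calc ∫ x in Ω, ‖weakGrad Ω v x‖ ^ 2 = energy hΩ v' v' := (energy_self hΩ v').symm
    _ ≤ energy hΩ (v' + w') (v' + w') := by
      simp only [map_add, LinearMap.add_apply]
      linarith
    _ = ∫ x in Ω, ‖weakGrad Ω (fun x => v x + w x) x‖ ^ 2 := energy_self hΩ _

end Energy

lemma exists_bilin_eq_of_anisotropic {K V : Type*} [Field K] [AddCommGroup V] [Module K V]
    [FiniteDimensional K V] (B : LinearMap.BilinForm K V) (hB : ∀ v, B v v = 0 → v = 0)
    (F : Module.Dual K V) : ∃ v, B v = F := by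
  have hinj : Function.Injective B := by
    refine (injective_iff_map_eq_zero B).2 fun v hv => hB v ?_
    rw [hv, LinearMap.zero_apply]
  exact (LinearMap.injective_iff_surjective_of_finrank_eq_finrank
    Subspace.dual_finrank_eq.symm).1 hinj F

/-! ### The discrete problem -/

namespace Triangulation

variable {Ω : Set Plane} {T : Triangulation Ω} {f g v w : Plane → ℝ}

lemma MemX.eqOn_of_eqOn_verts (hv : T.MemX v) (hw : T.MemX w)
    (h : ∀ K ∈ T.elements, Set.EqOn v w K.verts) : Set.EqOn v w (closure Ω) := by
  intro x hx
  obtain ⟨K, hK, hxK⟩ := T.exists_mem_carrier hx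
  obtain ⟨l, hl⟩ := hv.2 K hK
  obtain ⟨m, hm⟩ := hw.2 K hK
  have hlm : Set.EqOn l m K.verts := fun P hP => by
    rw [← hl (K.verts_subset_carrier hP), ← hm (K.verts_subset_carrier hP), h K hK hP]
  rw [hl hxK, hm hxK, AffineMap.eqOn_affineSpan hlm (convexHull_subset_affineSpan _ hxK)]

/-- The space `V_h`, its elements being extended by zero outside `closure Ω`. -/
def testSpace (T : Triangulation Ω) (hΩ : IsOpen Ω) (hb : Bornology.IsBounded Ω) :
    Submodule ℝ (h1Space Ω) where
  carrier := {v | T.MemV v ∧ ∀ x ∉ closure Ω, v.1 x = 0}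
  add_mem' hv hw := ⟨⟨hv.1.1.add hw.1.1, hv.1.2.add hΩ hw.1.2⟩, fun x hx => by
    simp [hv.2 x hx, hw.2 x hx]⟩
  zero_mem' := by
    obtain ⟨v, hv, -⟩ := T.exists_memX 0
    have hzero : T.MemX 0 := (hv.const_mul 0).congr fun x _ => by simp
    exact ⟨⟨hzero, hzero.memH10 hΩ hb fun _ _ => rfl⟩, fun _ _ => rfl⟩
  smul_mem' c v hv := ⟨⟨hv.1.1.const_mul c, hv.1.2.const_mul hΩ c⟩, fun x hx => by
    simp [hv.2 x hx]⟩

section TestSpace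

variable (hΩ : IsOpen Ω) (hb : Bornology.IsBounded Ω)

lemma testSpace_ext {v w : T.testSpace hΩ hb} (h : Set.EqOn v.1.1 w.1.1 (closure Ω)) : v = w := by
  refine Subtype.ext (Subtype.ext (funext fun x => ?_))
  by_cases hx : x ∈ closure Ω
  · exact h hx
  · rw [v.2.2 x hx, w.2.2 x hx]

instance finiteDimensional_testSpace : FiniteDimensional ℝ (T.testSpace hΩ hb) := by
  let nodes : Set Plane := ⋃ K ∈ T.elements, K.verts
  have : Finite nodes := T.elements.finite_toSet.biUnion fun K _ => K.finite_verts
  let eval : T.testSpace hΩ hb →ₗ[ℝ] nodes → ℝ :=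
    LinearMap.funLeft ℝ ℝ Subtype.val ∘ₗ (h1Space Ω).subtype ∘ₗ (T.testSpace hΩ hb).subtype
  refine Module.Finite.of_injective eval fun v w hvw => testSpace_ext hΩ hb ?_
  refine v.2.1.1.eqOn_of_eqOn_verts w.2.1.1 fun K hK P hP => ?_
  exact congrFun hvw ⟨P, Set.mem_biUnion (t := fun K : Triangle => K.verts) hK hP⟩

lemma testSpace_eq_zero_of_energy_self {v : T.testSpace hΩ hb} (h0 : energy hΩ v v = 0) :
    v = 0 := by
  have hcont : ContinuousOn v.1.1 (closure Ω) := v.2.1.1.1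
  have hzero : Set.EqOn v.1.1 0 Ω := Measure.eqOn_open_of_ae_eq
    (v.2.1.2.ae_eq_zero_of_energy_self hΩ hb h0) hΩ (hcont.mono subset_closure) continuousOn_const
  exact testSpace_ext hΩ hb
    (hzero.of_subset_closure hcont continuousOn_const subset_closure subset_rfl)

lemma exists_testSpace_eqOn (hv : T.MemV v) :
    ∃ w : T.testSpace hΩ hb, Set.EqOn w.1.1 v (closure Ω) := by
  have heq : Set.EqOn ((closure Ω).indicator v) v (closure Ω) := Set.eqOn_indicator
  have hH10 : MemH10 Ω ((closure Ω).indicator v) := hv.2.congr hΩ (heq.mono subset_closure).symm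
  exact ⟨⟨⟨_, hH10.1⟩, ⟨hv.1.congr heq, hH10⟩, fun x hx => Set.indicator_of_notMem hx v⟩, heq⟩

end TestSpace

lemma exists_isFEMSolution (hΩ : IsOpen Ω) (hb : Bornology.IsBounded Ω)
    (hf : MemLp f 2 (volume.restrict Ω)) (hg : T.MemX g) : ∃ U, T.IsFEMSolution f g U := by
  let V := T.testSpace hΩ hb
  let g' : h1Space Ω := ⟨g, hg.memH1 hΩ hb⟩
  obtain ⟨z, hz⟩ := exists_bilin_eq_of_anisotropic (V := V) ((energy hΩ).restrict V)
    (fun v hv => testSpace_eq_zero_of_energy_self hΩ hb hv)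
    ((load hf - energy hΩ g').domRestrict V)
  have hsolves (w : V) : energy hΩ (g' + z) w = load hf w := by
    have hzw : energy hΩ z w = load hf w - energy hΩ g' w := LinearMap.congr_fun hz w
    rw [map_add, LinearMap.add_apply, hzw, add_sub_cancel]
  refine ⟨(g' + z : h1Space Ω), hg.add z.2.1.1, by simpa [g'] using z.2.1, fun v hv => ?_⟩
  obtain ⟨w, hw⟩ := exists_testSpace_eqOn hΩ hb hv
  have hwΩ : Set.EqOn w.1.1 v Ω := hw.mono subset_closure
  rw [bilin_congr_right hΩ _ w.1.2 hwΩ]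
  refine (hsolves w).trans (setIntegral_congr_fun hΩ.measurableSet fun x hx => ?_)
  simp only [hwΩ hx]

lemma IsFEMSolution.h1Seminorm_sub_le (hΩ : IsOpen Ω) (hb : Bornology.IsBounded Ω)
    {u U : Plane → ℝ} (hu : IsWeakSolution Ω f u) (hU : T.IsFEMSolution f g U) (hw : T.MemX w)
    (hUw : MemH10 Ω fun x => U x - w x) :
    h1Seminorm Ω (fun x => u x - U x) ≤ h1Seminorm Ω fun x => u x - w x := by
  have hU1 := hU.1.memH1 hΩ hb
  have horth : bilin Ω (fun x => u x - U x) (fun x => U x - w x) = 0 := by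
    have hadd := hU1.bilin_add_left hΩ (hu.1.sub hU1) hUw.1
    simp only [add_sub_cancel] at hadd
    linarith [hu.2 _ hUw, hU.2.2 _ ⟨hU.1.sub hw, hUw⟩]
  simpa using h1Seminorm_le_of_bilin_eq_zero hΩ (hu.1.sub hU1) hUw.1 horth

end Triangulation

/-! ### The modified interpolant -/

namespace Triangle

variable (K : Triangle)

/-- The tent function on the disk of radius `r_K` around `A_K`, used to localize the
perturbation of the nodal value at `A_K`. -/
noncomputable def tent (x : Plane) : ℝ := max 0 (1 - dist x K.A / K.radius)

lemma tent_nonneg (x : Plane) : 0 ≤ K.tent x := le_max_left _ _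

lemma tent_le_one (x : Plane) : K.tent x ≤ 1 :=
  max_le zero_le_one (sub_le_self _ (div_nonneg dist_nonneg K.radius_pos.le))

lemma tent_A : K.tent K.A = 1 := by simp [tent]

lemma tent_eq_zero {x : Plane} (h : K.radius ≤ dist x K.A) : K.tent x = 0 :=
  max_eq_left (sub_nonpos.2 ((one_le_div K.radius_pos).2 h))

lemma abs_tent_sub_le (x y : Plane) : |K.tent x - K.tent y| ≤ dist x y / K.radius :=
  calc |K.tent x - K.tent y|
      ≤ |1 - dist x K.A / K.radius - (1 - dist y K.A / K.radius)| := by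
        rw [tent, tent, max_comm 0, max_comm 0]
        exact abs_max_sub_max_le_abs _ _ 0
    _ = |dist y K.A - dist x K.A| / K.radius := by
        rw [sub_sub_sub_cancel_left, ← sub_div, abs_div, abs_of_pos K.radius_pos]
    _ ≤ dist x y / K.radius := by
        rw [dist_comm x y]
        exact div_le_div_of_nonneg_right (abs_dist_sub_le y x K.A) K.radius_pos.le

end Triangle

namespace Triangulation

section Correction

variable {T₂ : Finset Triangle} {C₀ : ℝ} {δ : Triangle → ℝ} {K : Triangle} {P : Plane}

/-- The function added to `u` before interpolating: it moves the nodal value at `A_K` by `δ K`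
for each `K ∈ T₂`. -/
noncomputable def correction (T₂ : Finset Triangle) (δ : Triangle → ℝ) (x : Plane) : ℝ :=
  ∑ K ∈ T₂, δ K * K.tent x

open Classical in
/-- The elements of `T₂` whose disk contains a vertex of `K`. -/
noncomputable def touching (T₂ : Finset Triangle) (K : Triangle) : Finset Triangle :=
  T₂.filter fun K' => ∃ P ∈ K.verts, dist P K'.A < K'.radius

lemma correction_eq_zero (h : ∀ K ∈ T₂, K.radius ≤ dist P K.A) : correction T₂ δ P = 0 :=
  Finset.sum_eq_zero fun K hK => by rw [K.tent_eq_zero (h K hK), mul_zero]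

lemma lipschitzOnWith_correction {c : Triangle → NNReal}
    (hδ : ∀ K ∈ T₂, |δ K| ≤ c K * K.radius) (K : Triangle) :
    LipschitzOnWith (∑ K' ∈ touching T₂ K, c K') (correction T₂ δ) K.verts := by
  refine LipschitzOnWith.of_dist_le_mul fun P hP Q hQ => ?_
  rw [Real.dist_eq, correction, correction, ← Finset.sum_sub_distrib, touching, NNReal.coe_sum,
    Finset.sum_mul, Finset.sum_filter]
  refine (Finset.abs_sum_le_sum_abs _ _).trans (Finset.sum_le_sum fun K' hK' => ?_)
  split_ifs with h
  · calc |δ K' * K'.tent P - δ K' * K'.tent Q| = |δ K'| * |K'.tent P - K'.tent Q| := by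
          rw [← mul_sub, abs_mul]
      _ ≤ c K' * K'.radius * (dist P Q / K'.radius) := by
          gcongr
          exacts [(abs_nonneg _).trans (hδ K' hK'), hδ K' hK', K'.abs_tent_sub_le P Q]
      _ = c K' * dist P Q := by
          field_simp [K'.radius_pos.ne']
  · push Not at h
    simp [K'.tent_eq_zero (h P hP), K'.tent_eq_zero (h Q hQ)]

namespace Separated

lemma eq_of_dist_lt (hS : Separated T₂ C₀) {K' : Triangle} (hK : K ∈ T₂) (hK' : K' ∈ T₂)
    (h : dist P K.A < K.radius) (h' : dist P K'.A < K'.radius) : K = K' := by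
  by_contra hne
  linarith [hS.dist_A K hK K' hK' hne, dist_triangle_left K.A K'.A P]

lemma correction_eq (hS : Separated T₂ C₀) (hK : K ∈ T₂) (h : dist P K.A < K.radius) :
    correction T₂ δ P = δ K * K.tent P := by
  refine Finset.sum_eq_single_of_mem K hK fun K' hK' hne => ?_
  rw [K'.tent_eq_zero (not_lt.1 fun h' => hne (hS.eq_of_dist_lt hK' hK h' h)), mul_zero]

lemma correction_A (hS : Separated T₂ C₀) (hK : K ∈ T₂) : correction T₂ δ K.A = δ K := by
  rw [hS.correction_eq hK (by simpa using K.radius_pos), K.tent_A, mul_one]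

lemma correction_B (hS : Separated T₂ C₀) (hK : K ∈ T₂) : correction T₂ δ K.B = 0 :=
  correction_eq_zero fun K' hK' => dist_comm K'.A K.B ▸ hS.dist_B K' hK' K hK

lemma correction_C (hS : Separated T₂ C₀) (hK : K ∈ T₂) : correction T₂ δ K.C = 0 :=
  correction_eq_zero fun K' hK' => dist_comm K'.A K.C ▸ hS.dist_C K' hK' K hK

lemma card_touching_le (hS : Separated T₂ C₀) (K : Triangle) : (touching T₂ K).card ≤ 3 := by
  classical
  let N (P : Plane) : Finset Triangle := T₂.filter fun K' => dist P K'.A < K'.radius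
  have hN (P : Plane) : (N P).card ≤ 1 := Finset.card_le_one.2 fun K₁ h₁ K₂ h₂ => by
    rw [Finset.mem_filter] at h₁ h₂
    exact hS.eq_of_dist_lt h₁.1 h₂.1 h₁.2 h₂.2
  have hsub : touching T₂ K ⊆ ({K.A, K.B, K.C} : Finset Plane).biUnion N := fun K' hK' => by
    simpa [touching, N, Triangle.verts, and_or_left] using hK'
  calc (touching T₂ K).card ≤ (({K.A, K.B, K.C} : Finset Plane).biUnion N).card :=
        Finset.card_le_card hsub
    _ ≤ ({K.A, K.B, K.C} : Finset Plane).card * 1 :=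
        Finset.card_biUnion_le_card_mul _ _ _ fun P _ => hN P
    _ ≤ 3 := by
        rw [mul_one]
        exact Finset.card_le_three

lemma sq_sum_touching_le (hS : Separated T₂ C₀) (a : Triangle → ℝ) (K : Triangle) :
    (∑ K' ∈ touching T₂ K, a K') ^ 2 ≤ 3 * ∑ K' ∈ touching T₂ K, a K' ^ 2 := by
  refine sq_sum_le_card_mul_sum_sq.trans ?_
  gcongr
  exact_mod_cast hS.card_touching_le K

end Separated

end Correction

section ModifiedInterpolant

variable {Ω : Set Plane} {T : Triangulation Ω} {T₂ : Finset Triangle} {C₀ : ℝ} {u w : Plane → ℝ}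
  {δ : Triangle → ℝ} {K : Triangle}

lemma Separated.isAdaptedDatum (hS : Separated T₂ C₀) {C : ℝ} (hw : T.MemX w)
    (hwv : ∀ K ∈ T.elements, Set.EqOn w (u + correction T₂ δ) K.verts)
    (hδ : ∀ K ∈ T₂, |δ K| ≤ C * K.diam ^ 2) : T.IsAdaptedDatum T₂ u C w where
  memX := hw
  interp := by
    rintro P ⟨-, K, hK, hP⟩ hfar
    rw [hwv K hK hP, Pi.add_apply, correction_eq_zero hfar, add_zero]
  near := by
    rintro P ⟨-, K, hK, hP⟩ K' hK' hnear
    rw [hwv K hK hP, Pi.add_apply, add_sub_cancel_left, hS.correction_eq hK' hnear, abs_mul,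
      abs_of_nonneg (K'.tent_nonneg P)]
    exact (mul_le_of_le_one_right (abs_nonneg _) (K'.tent_le_one P)).trans (hδ K' hK')

lemma exists_modifiedInterpolant (hS : Separated T₂ C₀) (hT : T₂ ⊆ T.elements)
    {q : Triangle → Plane} {L : NNReal} (hu : ∀ K ∈ T.elements,
      ApproximatesLinearOn u (innerSL ℝ (q K)) K.verts (L * K.diam.toNNReal)) :
    ∃ w, T.IsAdaptedDatum T₂ u (2 * L) w ∧
      (∀ K ∈ T₂, ∀ l : Plane →ᵃ[ℝ] ℝ, Set.EqOn w l K.verts →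
        ‖affineGrad l - q K‖ ≤ L * K.diam) ∧
      ∀ K ∈ T.elements, ApproximatesLinearOn w (innerSL ℝ (q K)) K.verts
        (L * K.diam.toNNReal + ∑ K' ∈ touching T₂ K, 4 * (L * K'.diam.toNNReal)) := by
  choose! δ hδ hδl using fun K hK => Triangle.exists_perturbation K (hu K hK)
  obtain ⟨w, hw, hwv⟩ := T.exists_memX (u + correction T₂ δ)
  refine ⟨w, hS.isAdaptedDatum hw hwv fun K hK => ?_, fun K hK l hl => ?_, fun K hK => ?_⟩
  · calc |δ K| ≤ 4 * (L * K.diam) * K.radius := by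
          simpa [K.diam_nonneg] using hδ K (hT hK)
      _ ≤ 4 * (L * K.diam) * (K.diam / 2) := by
          have := K.diam_nonneg
          gcongr
          exact K.radius_le_half_diam
      _ = 2 * L * K.diam ^ 2 := by ring
  · have hlv {P : Plane} (hP : P ∈ K.verts) : l P = u P + correction T₂ δ P := by
      rw [← hl hP, hwv K (hT hK) hP, Pi.add_apply]
    simpa [K.diam_nonneg] using hδl K (hT hK) l
      (by rw [hlv K.A_mem_verts, hS.correction_A hK])
      (by rw [hlv K.B_mem_verts, hS.correction_B hK, add_zero])
      (by rw [hlv K.C_mem_verts, hS.correction_C hK, add_zero])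
  · have hcorr := lipschitzOnWith_correction (c := fun K' => 4 * (L * K'.diam.toNNReal))
      (fun K' hK' => by exact_mod_cast hδ K' (hT hK')) K
    refine LipschitzOnWith.approximatesLinearOn fun P hP Q hQ => ?_
    have hsum := (hu K hK).lipschitzOnWith.add hcorr hP hQ
    simpa only [Pi.sub_apply, Pi.add_apply, hwv K hK hP, hwv K hK hQ, sub_add_eq_add_sub] using hsum

/-- The weight `h_K²` spread over the disk of radius `2h` around `A_K`, summed over `K ∈ T₂`;
up to a constant it bounds the squared error caused by the corrections. -/
noncomputable def diskWeight (T₂ : Finset Triangle) (h : ℝ) (x : Plane) : ℝ :=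
  ∑ K ∈ T₂, (Metric.closedBall K.A (2 * h)).indicator (fun _ => K.diam ^ 2) x

lemma diskWeight_nonneg (T₂ : Finset Triangle) (h : ℝ) (x : Plane) : 0 ≤ diskWeight T₂ h x :=
  Finset.sum_nonneg fun _ _ => Set.indicator_nonneg (fun _ _ => sq_nonneg _) _

lemma sum_touching_le {h : ℝ} (hK : K.diam ≤ h) (hT : ∀ K' ∈ T₂, K'.diam ≤ h) {x : Plane}
    (hx : x ∈ K.carrier) : ∑ K' ∈ touching T₂ K, K'.diam ^ 2 ≤ diskWeight T₂ h x := by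
  rw [touching, Finset.sum_filter]
  refine Finset.sum_le_sum fun K' hK' => ?_
  split_ifs with htouch
  · obtain ⟨P, hP, hPA⟩ := htouch
    rw [Set.indicator_of_mem]
    rw [Metric.mem_closedBall]
    linarith [dist_triangle x P K'.A, K.dist_le_diam hx (K.verts_subset_carrier hP), hT K' hK',
      K'.radius_le_half_diam, K'.diam_nonneg]
  · exact Set.indicator_nonneg (fun _ _ => sq_nonneg _) _

lemma integrable_indicator_closedBall (A : Plane) (r c : ℝ) :
    Integrable ((Metric.closedBall A r).indicator fun _ => c) := by
  rw [integrable_indicator_iff measurableSet_closedBall]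
  exact integrableOn_const measure_closedBall_lt_top.ne

lemma integrable_diskWeight (T₂ : Finset Triangle) (h : ℝ) : Integrable (diskWeight T₂ h) :=
  integrable_finsetSum _ fun K _ => integrable_indicator_closedBall K.A _ _

lemma integral_diskWeight (T₂ : Finset Triangle) {h : ℝ} (hh : 0 ≤ h) :
    ∫ x, diskWeight T₂ h x =
      4 * volume.real (Metric.ball (0 : Plane) 1) * (∑ K ∈ T₂, K.diam ^ 2) * h ^ 2 := by
  have hball (A : Plane) : volume.real (Metric.closedBall A (2 * h)) =
      4 * volume.real (Metric.ball (0 : Plane) 1) * h ^ 2 := by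
    rw [measureReal_def, Measure.addHaar_closedBall _ _ (by positivity), ENNReal.toReal_mul,
      ENNReal.toReal_ofReal (by positivity), finrank_euclideanSpace, Fintype.card_fin,
      ← measureReal_def]
    ring
  simp only [diskWeight]
  rw [integral_finsetSum _ fun K _ => integrable_indicator_closedBall K.A _ _, Finset.mul_sum,
    Finset.sum_mul]
  refine Finset.sum_congr rfl fun K _ => ?_
  rw [integral_indicator measurableSet_closedBall, setIntegral_const, hball, smul_eq_mul]
  ring

end ModifiedInterpolant

end Triangulation

/-! ### The approximation error -/

namespace Triangulation

variable {Ω : Set Plane} {T : Triangulation Ω} {T₂ : Finset Triangle} {C₀ : ℝ} {u w : Plane → ℝ}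
  {G : Plane → Plane} {L : NNReal} {κ : ℝ}

section Elementwise

variable {K : Triangle} {l : Plane →ᵃ[ℝ] ℝ} {q : Plane}

lemma norm_affineGrad_sub_le {m D : NNReal} (hκ : 0 < κ)
    (hl₂ : K ∈ T₂ → ‖affineGrad l - q‖ ≤ m) (hang : K ∉ T₂ → κ ≤ Real.sin K.maxAngle)
    (hl : ApproximatesLinearOn l (innerSL ℝ q) K.verts (m + D)) :
    ‖affineGrad l - q‖ ≤ m + 2 * (m + D) / κ := by
  by_cases hK : K ∈ T₂
  · exact (hl₂ hK).trans (le_add_of_nonneg_right (by positivity))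
  · refine le_add_of_nonneg_of_le m.2 ((le_div_iff₀ hκ).2 ?_)
    calc ‖affineGrad l - q‖ * κ ≤ ‖affineGrad l - q‖ * Real.sin K.maxAngle := by
          gcongr
          exact hang hK
      _ ≤ 2 * (m + D) := by exact_mod_cast K.norm_affineGrad_sub_mul_sin_le hl

lemma sq_le_of_le_add_div {y a D S : ℝ} (hy : 0 ≤ y) (hya : y ≤ 2 * a + 2 * (a + D) / κ)
    (hD : D ^ 2 ≤ S) : y ^ 2 ≤ (8 + 16 / κ ^ 2) * a ^ 2 + 16 / κ ^ 2 * S :=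
  calc y ^ 2 ≤ (2 * a + 2 * (a + D) / κ) ^ 2 := pow_le_pow_left₀ hy hya 2
    _ ≤ 2 * ((2 * a) ^ 2 + (2 * (a + D) / κ) ^ 2) := add_sq_le
    _ = 8 * a ^ 2 + 8 / κ ^ 2 * (a + D) ^ 2 := by ring
    _ ≤ 8 * a ^ 2 + 8 / κ ^ 2 * (2 * (a ^ 2 + D ^ 2)) := by
        gcongr
        exact add_sq_le
    _ ≤ 8 * a ^ 2 + 8 / κ ^ 2 * (2 * (a ^ 2 + S)) := by gcongr
    _ = (8 + 16 / κ ^ 2) * a ^ 2 + 16 / κ ^ 2 * S := by ring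

lemma Separated.sq_norm_sub_affineGrad_le (hS : Separated T₂ C₀) (hκ : 0 < κ) {h : ℝ}
    (hK : K.diam ≤ h) (hT : ∀ K' ∈ T₂, K'.diam ≤ h) {p : Plane} (hp : ‖p - q‖ ≤ L * K.diam)
    (hl₂ : K ∈ T₂ → ‖affineGrad l - q‖ ≤ L * K.diam)
    (hang : K ∉ T₂ → κ ≤ Real.sin K.maxAngle)
    (hl : ApproximatesLinearOn l (innerSL ℝ q) K.verts
      (L * K.diam.toNNReal + ∑ K' ∈ touching T₂ K, 4 * (L * K'.diam.toNNReal)))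
    {x : Plane} (hx : x ∈ K.carrier) :
    ‖p - affineGrad l‖ ^ 2 ≤
      L ^ 2 * ((8 + 16 / κ ^ 2) * h ^ 2 + 768 / κ ^ 2 * diskWeight T₂ h x) := by
  let D : ℝ := ∑ K' ∈ touching T₂ K, 4 * (L * K'.diam)
  have hgrad : ‖affineGrad l - q‖ ≤ L * K.diam + 2 * (L * K.diam + D) / κ := by
    simpa [Triangle.diam_nonneg, D] using norm_affineGrad_sub_le hκ
      (by simpa [Triangle.diam_nonneg] using hl₂) hang hl
  have hnorm : ‖p - affineGrad l‖ ≤ 2 * (L * h) + 2 * (L * h + D) / κ :=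
    calc ‖p - affineGrad l‖ ≤ ‖p - q‖ + ‖affineGrad l - q‖ := by
          rw [norm_sub_rev (affineGrad l) q]
          exact norm_sub_le_norm_sub_add_norm_sub p q _
      _ ≤ 2 * (L * K.diam) + 2 * (L * K.diam + D) / κ := by linarith
      _ ≤ 2 * (L * h) + 2 * (L * h + D) / κ := by gcongr
  have hD : D ^ 2 ≤ 48 * L ^ 2 * diskWeight T₂ h x :=
    calc D ^ 2 ≤ 3 * ∑ K' ∈ touching T₂ K, (4 * (L * K'.diam)) ^ 2 := hS.sq_sum_touching_le _ K
      _ = 48 * L ^ 2 * ∑ K' ∈ touching T₂ K, K'.diam ^ 2 := by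
          simp only [Finset.mul_sum]
          exact Finset.sum_congr rfl fun _ _ => by ring
      _ ≤ 48 * L ^ 2 * diskWeight T₂ h x := by
          gcongr
          exact sum_touching_le hK hT hx
  refine (sq_le_of_le_add_div (norm_nonneg _) hnorm hD).trans_eq ?_
  ring

end Elementwise

lemma exists_isAdaptedDatum_sq_norm_sub_gradient_le (hΩ : IsOpen Ω) (hκ : 0 < κ)
    (hT : T₂ ⊆ T.elements) (hang : ∀ K ∈ T.elements, K ∉ T₂ → κ ≤ Real.sin K.maxAngle)
    (hS : Separated T₂ C₀) (hu : ∀ K ∈ T.elements, ∃ q : Plane,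
      (∀ᵐ x ∂(volume.restrict (interior K.carrier)), ‖G x - q‖ ≤ L * K.diam) ∧
        ApproximatesLinearOn u (innerSL ℝ q) K.carrier (L * K.diam.toNNReal)) :
    ∃ w, T.IsAdaptedDatum T₂ u (2 * L) w ∧
      ∀ᵐ x ∂(volume.restrict Ω), ‖G x - gradient w x‖ ^ 2 ≤ L ^ 2 *
        ((8 + 16 / κ ^ 2) * T.meshSize ^ 2 + 768 / κ ^ 2 * diskWeight T₂ T.meshSize x) := by
  choose! q hqG hqu using hu
  obtain ⟨w, hw, hw₂, hwlin⟩ := exists_modifiedInterpolant hS hT fun K hK =>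
    (hqu K hK).mono_set K.verts_subset_carrier
  refine ⟨w, hw, ?_⟩
  have hG : ∀ᵐ x, ∀ K ∈ T.elements, x ∈ interior K.carrier → ‖G x - q K‖ ≤ L * K.diam :=
    T.elements.eventually_all.2 fun K hK =>
      (ae_restrict_iff' isOpen_interior.measurableSet).1 (hqG K hK)
  filter_upwards [T.ae_exists_mem_interior hΩ, ae_restrict_of_ae hG] with x ⟨K, hK, hx⟩ hGx
  obtain ⟨l, hl⟩ := hw.memX.2 K hK
  have hlv := hl.mono K.verts_subset_carrier
  rw [(hasGradientAt_of_eqOn_affine hl hx).gradient]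
  refine hS.sq_norm_sub_affineGrad_le hκ (T.diam_le_meshSize hK)
    (fun K' hK' => T.diam_le_meshSize (hT hK')) (hGx K hK hx) (fun hK₂ => hw₂ K hK₂ l hlv)
    (hang K hK) (fun P hP Q hQ => ?_) (interior_subset hx)
  rw [← hlv hP, ← hlv hQ]
  exact hwlin K hK P hP Q hQ

lemma meshSize_nonneg (T : Triangulation Ω) : 0 ≤ T.meshSize :=
  Real.sSup_nonneg (Set.forall_mem_image.2 fun K _ => K.diam_nonneg)

lemma setIntegral_diskWeight_le (Ω : Set Plane) {h : ℝ} (hh : 0 ≤ h)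
    (hC₀ : ∑ K ∈ T₂, K.diam ^ 2 ≤ C₀) :
    ∫ x in Ω, diskWeight T₂ h x ≤
      4 * volume.real (Metric.ball (0 : Plane) 1) * C₀ * h ^ 2 :=
  calc ∫ x in Ω, diskWeight T₂ h x ≤ ∫ x, diskWeight T₂ h x :=
        setIntegral_le_integral (integrable_diskWeight T₂ h)
          (.of_forall (diskWeight_nonneg T₂ h))
    _ = 4 * volume.real (Metric.ball (0 : Plane) 1) * (∑ K ∈ T₂, K.diam ^ 2) * h ^ 2 :=
        integral_diskWeight T₂ hh
    _ ≤ 4 * volume.real (Metric.ball (0 : Plane) 1) * C₀ * h ^ 2 := by gcongr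

lemma MemX.h1Seminorm_sub_le (hΩ : IsOpen Ω) (hb : Bornology.IsBounded Ω) (hu : MemH1 Ω u)
    (hw : T.MemX w) {a b h : ℝ} (hb0 : 0 ≤ b) (hh : 0 ≤ h) (hC₀ : ∑ K ∈ T₂, K.diam ^ 2 ≤ C₀)
    (herr : ∀ᵐ x ∂(volume.restrict Ω), ‖weakGrad Ω u x - gradient w x‖ ^ 2 ≤
      L ^ 2 * (a * h ^ 2 + b * diskWeight T₂ h x)) :
    h1Seminorm Ω (fun x => u x - w x) ≤
      √(a * volume.real Ω + b * (4 * volume.real (Metric.ball (0 : Plane) 1) * C₀)) * (L * h) := by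
  have : IsFiniteMeasure (volume.restrict Ω) := isFiniteMeasure_restrict.2 hb.measure_lt_top.ne
  have hconst : Integrable (fun _ : Plane => a * h ^ 2) (volume.restrict Ω) := integrable_const _
  have hweight : Integrable (fun x => b * diskWeight T₂ h x) (volume.restrict Ω) :=
    (integrable_diskWeight T₂ h).integrableOn.const_mul b
  have hgrad : ∀ᵐ x ∂(volume.restrict Ω), ‖weakGrad Ω (fun x => u x - w x) x‖ ^ 2 ≤
      L ^ 2 * (a * h ^ 2 + b * diskWeight T₂ h x) := by
    filter_upwards [hu.weakGrad_sub hΩ (hw.memH1 hΩ hb),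
      (hw.isWeakGrad hΩ hb).weakGrad_ae_eq hΩ, herr] with x hsub hwx hx
    rwa [hsub, hwx]
  rw [← Real.sqrt_sq (by positivity : 0 ≤ L * h), ← Real.sqrt_mul' _ (sq_nonneg _)]
  refine Real.sqrt_le_sqrt ?_
  calc ∫ x in Ω, ‖weakGrad Ω (fun x => u x - w x) x‖ ^ 2
      ≤ ∫ x in Ω, L ^ 2 * (a * h ^ 2 + b * diskWeight T₂ h x) :=
        integral_mono_of_nonneg (.of_forall fun _ => by positivity)
          ((hconst.add hweight).const_mul _) hgrad
    _ = L ^ 2 * (volume.real Ω * (a * h ^ 2) + b * ∫ x in Ω, diskWeight T₂ h x) := by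
        rw [integral_const_mul, integral_add hconst hweight, setIntegral_const, smul_eq_mul,
          integral_const_mul]
    _ ≤ L ^ 2 * (volume.real Ω * (a * h ^ 2) +
          b * (4 * volume.real (Metric.ball (0 : Plane) 1) * C₀ * h ^ 2)) := by
        gcongr
        exact setIntegral_diskWeight_le Ω hh hC₀
    _ = _ := by ring

lemma exists_isAdaptedDatum_h1Seminorm_sub_le (hΩ : IsOpen Ω) (hb : Bornology.IsBounded Ω)
    (hreg : interior (closure Ω) = Ω) {α₀ : ℝ} (hα₀ : α₀ < Real.pi) (C₀ : ℝ)
    (hu : MemW2Inf Ω u) (hu_cont : ContinuousOn u (closure Ω)) (hu1 : MemH1 Ω u) :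
    ∃ C : ℝ, ∀ (T : Triangulation Ω) (T₂ : Finset Triangle), T₂ ⊆ T.elements →
      (∀ K ∈ T.elements, K ∉ T₂ → K.maxAngle ≤ α₀) → Separated T₂ C₀ →
      ∃ w, T.IsAdaptedDatum T₂ u C w ∧ h1Seminorm Ω (fun x => u x - w x) ≤ C * T.meshSize := by
  obtain ⟨κ, hκ, hsin⟩ := exists_pos_le_sin (β := Real.pi / 3) (by positivity) hα₀
  obtain ⟨L, hL⟩ := hu.exists_approximatesLinearOn hΩ
  let A : ℝ := (8 + 16 / κ ^ 2) * volume.real Ω +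
    768 / κ ^ 2 * (4 * volume.real (Metric.ball (0 : Plane) 1) * C₀)
  refine ⟨max (2 * (L : ℝ)) (√A * L), fun T T₂ hT hang hS => ?_⟩
  obtain ⟨w, hw, herr⟩ := exists_isAdaptedDatum_sq_norm_sub_gradient_le (G := weakGrad Ω u)
    (u := u) (L := L) hΩ hκ hT
    (fun K hK hK₂ => hsin _ K.pi_div_three_le_maxAngle (hang K hK hK₂)) hS fun K hK => by
      simpa only [K.diam_interior_carrier, K.closure_interior_carrier] using
        hL _ (T.interior_carrier_subset hreg hK) isOpen_interior K.convex_carrier.interior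
          K.interior_carrier_nonempty (K.isCompact_carrier.isBounded.subset interior_subset)
          (hu_cont.mono (K.closure_interior_carrier.trans_subset (T.carrier_subset hK)))
  refine ⟨w, ⟨hw.memX, hw.interp, fun P hP K hK hPK => (hw.near P hP K hK hPK).trans ?_⟩, ?_⟩
  · gcongr
    exact le_max_left _ _
  · have hh := T.meshSize_nonneg
    calc h1Seminorm Ω (fun x => u x - w x) ≤ √A * (L * T.meshSize) :=
          hw.memX.h1Seminorm_sub_le hΩ hb hu1 (by positivity) hh hS.sum_le herr
      _ = √A * L * T.meshSize := (mul_assoc _ _ _).symm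
      _ ≤ max (2 * (L : ℝ)) (√A * L) * T.meshSize := by
          gcongr
          exact le_max_right _ _

end Triangulation

end FEM

theorem theorem3p3_general (Ω : Set FEM.Plane) (hΩ_open : IsOpen Ω)
    (hΩ_bdd : Bornology.IsBounded Ω) (hΩ_reg : interior (closure Ω) = Ω)
    (α₀ : ℝ) (hα₀ : α₀ < Real.pi) (C₀ : ℝ)
    (f u : FEM.Plane → ℝ) (hf : MemLp f 2 (volume.restrict Ω))
    (hu : FEM.MemW2Inf Ω u) (hu_cont : ContinuousOn u (closure Ω))
    (huf : FEM.IsWeakSolution Ω f u) :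
    ∃ C : ℝ, ∀ (T : FEM.Triangulation Ω) (T₂ : Finset FEM.Triangle), T₂ ⊆ T.elements →
      (∀ K ∈ T.elements, K ∉ T₂ → K.maxAngle ≤ α₀) →
      FEM.Triangulation.Separated T₂ C₀ →
      ∃ g₀ : FEM.Plane → ℝ, T.IsAdaptedDatum T₂ u C g₀ ∧
        ∀ g : FEM.Plane → ℝ, T.MemX g → Set.EqOn g g₀ (frontier Ω) →
          (∃ U : FEM.Plane → ℝ, T.IsFEMSolution f g U) ∧
          ∀ U : FEM.Plane → ℝ, T.IsFEMSolution f g U →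
            FEM.MemH1 Ω (fun x => u x - U x) ∧
              FEM.h1Seminorm Ω (fun x => u x - U x) ≤ C * T.meshSize := by
  obtain ⟨C, hC⟩ := FEM.Triangulation.exists_isAdaptedDatum_h1Seminorm_sub_le
    hΩ_open hΩ_bdd hΩ_reg hα₀ C₀ hu hu_cont huf.1
  refine ⟨C, fun T T₂ hT hang hS => ?_⟩
  obtain ⟨g₀, hg₀, herr⟩ := hC T T₂ hT hang hS
  refine ⟨g₀, hg₀, fun g hg hgg₀ => ⟨T.exists_isFEMSolution hΩ_open hΩ_bdd hf hg, fun U hU => ?_⟩⟩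
  have hgap : FEM.MemH10 Ω (fun x => g x - g₀ x) :=
    (hg.sub hg₀.memX).memH10 hΩ_open hΩ_bdd fun x hx => sub_eq_zero.2 (hgg₀ hx)
  have hUg₀ : FEM.MemH10 Ω (fun x => U x - g₀ x) := by
    simpa only [sub_add_sub_cancel] using hU.2.1.2.add hΩ_open hgap
  exact ⟨huf.1.sub (hU.1.memH1 hΩ_open hΩ_bdd),
    (hU.h1Seminorm_sub_le hΩ_open hΩ_bdd huf hg₀.memX hUg₀).trans herr⟩

theorem theorem3p3 (Ω : Set FEM.Plane) (hΩ_open : IsOpen Ω) (hΩ_conn : IsConnected Ω)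
    (hΩ_bdd : Bornology.IsBounded Ω) (hΩ_reg : interior (closure Ω) = Ω)
    (α₀ : ℝ) (hα₀ : α₀ < Real.pi) (C₀ : ℝ)
    (f u : FEM.Plane → ℝ) (hf : MemLp f 2 (volume.restrict Ω))
    (hu : FEM.MemW2Inf Ω u) (hu_cont : ContinuousOn u (closure Ω))
    (huf : FEM.IsWeakSolution Ω f u) :
    ∃ C : ℝ, ∀ (T : FEM.Triangulation Ω) (T₂ : Finset FEM.Triangle), T₂ ⊆ T.elements →
      (∀ K ∈ T.elements, K ∉ T₂ → K.maxAngle ≤ α₀) →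
      FEM.Triangulation.Separated T₂ C₀ →
      ∃ g₀ : FEM.Plane → ℝ, T.IsAdaptedDatum T₂ u C g₀ ∧
        ∀ g : FEM.Plane → ℝ, T.MemX g → Set.EqOn g g₀ (frontier Ω) →
          (∃ U : FEM.Plane → ℝ, T.IsFEMSolution f g U) ∧
          ∀ U : FEM.Plane → ℝ, T.IsFEMSolution f g U →
            FEM.MemH1 Ω (fun x => u x - U x) ∧
              FEM.h1Seminorm Ω (fun x => u x - U x) ≤ C * T.meshSize :=
  theorem3p3_general Ω hΩ_open hΩ_bdd hΩ_reg α₀ hα₀ C₀ f u hf hu hu_cont huf
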